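/- Let $q\in(0,1)$ and let $k,l$ be coprime positive integers. Let $\mathcal O(S^3_q)$ be the complex unital $*$-algebra generated by $\alpha,\beta$ with relations $$\alpha\beta=q\beta\alpha,\quad \alpha\beta^*=q\beta^*\alpha,\quad \beta\beta^*=\beta^*\beta,\quad \alpha\alpha^*=\alpha^*\alpha+(q^{-2}-1)\beta\beta^*,\quad \alpha\alpha^*+\beta\beta^*=1,$$ let $\varrho:\mathcal O(S^3_q)\to\mathcal O(S^3_q)\otimes\mathbb C[u,u^{-1}]$ ($u$ unitary) be the $*$-algebra map with $\varrho(\alpha)=\alpha\otimes u^k$, $\varrho(\beta)=\beta\otimes u^{-l}$, and let $\mathcal O(\mathbb{WP}_q(k,l))=\{x:\varrho(x)=x\otimes 1\}$, a $*$-subalgebra containing $a=\beta\beta^*$ and $b=\alpha^l\beta^k$. Let $s\in\{1,\dots,l\}$. There are a unique unital $*$-homomorphism $\pi_0:\mathcal O(\mathbb{WP}_q(k,l))\to\mathbb C$ with $\pi_0(a)=\pi_0(b)=0$ and a unique unital $*$-representation $\pi_s$ of $\mathcal O(\mathbb{WP}_q(k,l))$ by bounded operators on $V_s=\ell^2(\mathbb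 N)$ (with standard orthonormal basis $(e_p)_{p\ge 0}$) such that $$\pi_s(a)e_p=q^{2(lp+s)}e_p,\qquad \pi_s(b)e_p=q^{k(lp+s)}\prod_{r=1}^{l}\bigl(1-q^{2(lp+s-r)}\bigr)^{1/2}e_{p-1}\ (p\ge1),\qquad \pi_s(b)e_0=0.$$ Let $V_0=\bigoplus_{p\in\mathbb N}\mathbb C\simeq\ell^2(\mathbb N)$ carry $\pi=\bigoplus\pi_0$ (so $\pi(x)=\pi_0(x)I$), let $\mathcal V_s=V_s\oplus V_0$, $\bar\pi_s=\pi_s\oplus\pi$, and $$F=\begin{pmatrix}0&I\\ I&0\end{pmatrix},\qquad \gamma=\begin{pmatrix}I&0\\0&-I\end{pmatrix}.$$ Then $(\mathcal V_s,\bar\pi_s,F,\gamma)$ is a 1-summable even Fredholm module over $\mathcal O(\mathbb{WP}_q(k,l))$: $F^*=F$, $F^2=I$, $\gamma^*=\gamma$, $\gamma^2=I$, $\gamma F=-F\gamma$, and for all $x$ the operator $\gamma$ commutes with $\bar\pi_s(x)$ and $[F,\bar\pi_s(x)]$ is compact and of trace class. Its Chern character $$\tau_s(x)=\tfrac12\operatorname{Tr}\bigl(\gamma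 F[F,\bar\pi_s(x)]\bigr)$$ is a linear functional with $\tau_s(xy)=\tau_s(yx)$ for all $x,y$. For every $x$ the operator $\pi_s(x)-\pi(x)$ is of trace class with $\tau_s(x)=\operatorname{Tr}(\pi_s(x)-\pi(x))$. Writing $b^{-n}$ for $(b^*)^n$ when $n>0$, for all $m\in\mathbb N$, $n\in\mathbb Z$ with $(m,n)\ne(0,0)$ the operator $\gamma\bar\pi_s(a^mb^n)$ is of trace class and $\tau_s(a^mb^n)=\operatorname{Tr}(\gamma\bar\pi_s(a^mb^n))$. For all $m\in\mathbb N$ and $n\in\mathbb Z$, $$\tau_s(a^mb^n)=\begin{cases}\dfrac{q^{2ms}}{1-q^{2ml}} & \text{if } n=0,\ m\neq0,\\[1ex] 0&\text{otherwise.}\end{cases}$$ -/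

import Mathlib

open scoped TensorProduct LaurentPolynomial

noncomputable section

namespace QuantumTeardrop

/-! ## Conjugate-linear anti-homomorphisms -/

/-- The opposite of a complex algebra with the conjugated scalar action. An algebra map
`A →ₐ[ℂ] ConjOp B` is the same thing as a unital conjugate-linear anti-multiplicative map from
`A` to `B`. -/
def ConjOp (B : Type*) := Bᵐᵒᵖ

instance instRingConjOp (B : Type*) [Ring B] : Ring (ConjOp B) :=
  inferInstanceAs (Ring Bᵐᵒᵖ)

instance instAlgebraConjOp (B : Type*) [Ring B] [Algebra ℂ B] : Algebra ℂ (ConjOp B) :=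
  Algebra.compHom Bᵐᵒᵖ (starRingEnd ℂ)

namespace ConjOp

variable {B : Type*}

/-- The tautological map `B → ConjOp B`. -/
def mk (x : B) : ConjOp B := MulOpposite.op x

/-- The tautological map `ConjOp B → B`. -/
def out (x : ConjOp B) : B := MulOpposite.unop x

@[simp] theorem out_mk (x : B) : out (mk x) = x := rfl

@[simp] theorem mk_out (x : ConjOp B) : mk (out x) = x := rfl

theorem out_injective : Function.Injective (out : ConjOp B → B) := MulOpposite.unop_injective

variable [Ring B]

@[simp] theorem out_add (x y : ConjOp B) : out (x + y) = out x + out y := rfl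
@[simp] theorem out_sub (x y : ConjOp B) : out (x - y) = out x - out y := rfl
@[simp] theorem out_mul (x y : ConjOp B) : out (x * y) = out y * out x := rfl
@[simp] theorem out_one : out (1 : ConjOp B) = 1 := rfl
@[simp] theorem mk_one : mk (1 : B) = 1 := rfl
theorem mk_mul (x y : B) : mk (x * y) = mk y * mk x := rfl

variable [Algebra ℂ B]

theorem algebraMap_eq (c : ℂ) :
    algebraMap ℂ (ConjOp B) c = mk (algebraMap ℂ B (starRingEnd ℂ c)) := rfl

@[simp] theorem out_algebraMap (c : ℂ) :
    out (algebraMap ℂ (ConjOp B) c) = algebraMap ℂ B (starRingEnd ℂ c) := rfl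

@[simp] theorem out_smul (c : ℂ) (x : ConjOp B) :
    out (c • x) = starRingEnd ℂ c • out x := by
  rw [Algebra.smul_def, out_mul, out_algebraMap, Algebra.smul_def]
  exact (Algebra.commutes _ _).symm

/-- Functoriality of `ConjOp`. -/
def map {C : Type*} [Ring C] [Algebra ℂ C] (f : B →ₐ[ℂ] C) : ConjOp B →ₐ[ℂ] ConjOp C where
  toFun x := mk (f (out x))
  map_one' := by simp
  map_mul' x y := by rw [out_mul, map_mul, mk_mul]
  map_zero' := congrArg mk (map_zero f)
  map_add' x y := congrArg mk (map_add f (out x) (out y))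
  commutes' c := by
    rw [out_algebraMap, AlgHom.commutes, algebraMap_eq]

@[simp] theorem out_map {C : Type*} [Ring C] [Algebra ℂ C] (f : B →ₐ[ℂ] C) (x : ConjOp B) :
    out (map f x) = f (out x) := rfl

end ConjOp

/-! ## The coordinate algebra of the quantum three-sphere -/

/-- The letters `α, α*, β, β*`. -/
inductive SphereGen
  | al | alStar | be | beStar

/-- The involution of the letters. -/
def SphereGen.inv : SphereGen → SphereGen
  | .al => .alStar
  | .alStar => .al
  | .be => .beStar
  | .beStar => .be

/-- The free complex algebra on `α, α*, β, β*`, i.e. the free `*`-algebra on `α, β`. -/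
abbrev FreeSphere := FreeAlgebra ℂ SphereGen

/-- A letter as an element of the free algebra. -/
abbrev letter (x : SphereGen) : FreeSphere := FreeAlgebra.ι ℂ x

open SphereGen in
/-- The relations of the quantum three-sphere (that is, of quantum `SU(2)`):
`αβ = qβα`, `αβ* = qβ*α`, `ββ* = β*β`, `αα* = α*α + (q⁻² - 1)ββ*`, `αα* + ββ* = 1`,
together with the adjoints of the first two (the other ones are self-adjoint). -/
inductive SphereRel (q : ℝ) : FreeSphere → FreeSphere → Prop
  | al_be : SphereRel q (letter al * letter be) ((q : ℂ) • (letter be * letter al))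
  | al_beStar : SphereRel q (letter al * letter beStar) ((q : ℂ) • (letter beStar * letter al))
  | al_be_star :
      SphereRel q (letter beStar * letter alStar) ((q : ℂ) • (letter alStar * letter beStar))
  | al_beStar_star :
      SphereRel q (letter be * letter alStar) ((q : ℂ) • (letter alStar * letter be))
  | be_normal : SphereRel q (letter be * letter beStar) (letter beStar * letter be)
  | al_alStar : SphereRel q (letter al * letter alStar)
      (letter alStar * letter al + ((q : ℂ) ^ (-2 : ℤ) - 1) • (letter be * letter beStar))
  | sphere : SphereRel q (letter al * letter alStar + letter be * letter beStar) 1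

/-- The coordinate algebra `O(S³_q) = O(SU_q(2))`. -/
def QSphere (q : ℝ) := RingQuot (SphereRel q)

namespace QSphere

variable (q : ℝ)

instance instRing : Ring (QSphere q) := inferInstanceAs (Ring (RingQuot (SphereRel q)))

instance instAlgebra : Algebra ℂ (QSphere q) :=
  inferInstanceAs (Algebra ℂ (RingQuot (SphereRel q)))

/-- The image of a letter in the quantum sphere algebra. -/
def gen (x : SphereGen) : QSphere q := RingQuot.mkAlgHom ℂ (SphereRel q) (letter x)

variable {q}

/-- The universal property of `O(S³_q)` with respect to complex algebras. -/
def lift {B : Type*} [Ring B] [Algebra ℂ B] (f : SphereGen → B)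
    (hf : ∀ ⦃x y⦄, SphereRel q x y → FreeAlgebra.lift ℂ f x = FreeAlgebra.lift ℂ f y) :
    QSphere q →ₐ[ℂ] B :=
  RingQuot.liftAlgHom ℂ ⟨FreeAlgebra.lift ℂ f, hf⟩

@[simp] theorem lift_gen {B : Type*} [Ring B] [Algebra ℂ B] (f : SphereGen → B)
    (hf : ∀ ⦃x y⦄, SphereRel q x y → FreeAlgebra.lift ℂ f x = FreeAlgebra.lift ℂ f y)
    (x : SphereGen) : lift f hf (gen q x) = f x := by
  unfold lift gen
  erw [RingQuot.liftAlgHom_mkAlgHom_apply]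
  simp

theorem hom_ext {B : Type*} [Ring B] [Algebra ℂ B] {f g : QSphere q →ₐ[ℂ] B}
    (h : ∀ x, f (gen q x) = g (gen q x)) : f = g := by
  refine RingQuot.ringQuot_ext' (s := SphereRel q) ℂ f g (FreeAlgebra.hom_ext ?_)
  funext x
  exact h x

open SphereGen

theorem al_be : gen q al * gen q be = (q : ℂ) • (gen q be * gen q al) := by
  simpa only [gen, map_mul, map_smul] using!
    RingQuot.mkAlgHom_rel ℂ (SphereRel.al_be (q := q))

theorem al_beStar : gen q al * gen q beStar = (q : ℂ) • (gen q beStar * gen q al) := by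
  simpa only [gen, map_mul, map_smul] using!
    RingQuot.mkAlgHom_rel ℂ (SphereRel.al_beStar (q := q))

theorem al_be_star : gen q beStar * gen q alStar = (q : ℂ) • (gen q alStar * gen q beStar) := by
  simpa only [gen, map_mul, map_smul] using!
    RingQuot.mkAlgHom_rel ℂ (SphereRel.al_be_star (q := q))

theorem al_beStar_star : gen q be * gen q alStar = (q : ℂ) • (gen q alStar * gen q be) := by
  simpa only [gen, map_mul, map_smul] using!
    RingQuot.mkAlgHom_rel ℂ (SphereRel.al_beStar_star (q := q))

theorem be_normal : gen q be * gen q beStar = gen q beStar * gen q be := by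
  simpa [gen] using! RingQuot.mkAlgHom_rel ℂ (SphereRel.be_normal (q := q))

theorem al_alStar : gen q al * gen q alStar = gen q alStar * gen q al +
    ((q : ℂ) ^ (-2 : ℤ) - 1) • (gen q be * gen q beStar) := by
  simpa only [gen, map_add, map_mul, map_smul] using!
    RingQuot.mkAlgHom_rel ℂ (SphereRel.al_alStar (q := q))

theorem sphere : gen q al * gen q alStar + gen q be * gen q beStar = 1 := by
  simpa [gen] using! RingQuot.mkAlgHom_rel ℂ (SphereRel.sphere (q := q))

/-- The involution of `O(S³_q)`: the conjugate-linear anti-multiplicative map that exchanges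
`α` with `α*` and `β` with `β*`. -/
def starHom (q : ℝ) : QSphere q →ₐ[ℂ] ConjOp (QSphere q) :=
  lift (fun x => ConjOp.mk (gen q x.inv)) (by
    intro x y h
    apply ConjOp.out_injective
    cases h
    all_goals simp only [letter, map_mul, map_add, map_smul, map_one, FreeAlgebra.lift_ι_apply,
      ConjOp.out_mul, ConjOp.out_add, ConjOp.out_smul, ConjOp.out_mk, ConjOp.out_one,
      SphereGen.inv, map_sub, map_zpow₀, Complex.conj_ofReal]
    · exact al_be_star
    · exact al_beStar_star
    · exact al_be
    · exact al_beStar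
    · exact be_normal
    · exact al_alStar
    · exact sphere)

theorem starHom_gen (x : SphereGen) : starHom q (gen q x) = ConjOp.mk (gen q x.inv) :=
  lift_gen _ _ x

theorem starHom_starHom (x : QSphere q) :
    ConjOp.out (starHom q (ConjOp.out (starHom q x))) = x := by
  have h : ∀ x : QSphere q, x ∈ (⊤ : Subalgebra ℂ (QSphere q)) := fun _ => trivial
  let φ : QSphere q →ₐ[ℂ] QSphere q :=
    { toFun := fun x => ConjOp.out (starHom q (ConjOp.out (starHom q x)))
      map_one' := by simp
      map_mul' := fun x y => by simp
      map_zero' := by rw [map_zero]; exact congrArg ConjOp.out (map_zero (starHom q))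
      map_add' := fun x y => by simp
      commutes' := fun c => by simp }
  have hφ : φ = AlgHom.id ℂ _ := by
    apply hom_ext
    intro x
    change ConjOp.out (starHom q (ConjOp.out (starHom q (gen q x)))) = gen q x
    rw [starHom_gen, ConjOp.out_mk, starHom_gen, ConjOp.out_mk]
    cases x <;> rfl
  exact DFunLike.congr_fun hφ x

instance instStarRing : StarRing (QSphere q) where
  star x := ConjOp.out (starHom q x)
  star_involutive := starHom_starHom
  star_mul x y := by simp
  star_add x y := by simp

theorem star_def (x : QSphere q) : star x = ConjOp.out (starHom q x) := rfl

instance instStarModule : StarModule ℂ (QSphere q) where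
  star_smul c x := by simp [star_def]

@[simp] theorem star_gen (x : SphereGen) : star (gen q x) = gen q x.inv := by
  rw [star_def, starHom_gen, ConjOp.out_mk]

/-! ## The coaction and the quantum weighted projective line -/

/-- The degree of the letters: `α` has degree `k` and `β` has degree `-l`. -/
def degree (k l : ℕ) : SphereGen → ℤ
  | al => k
  | alStar => -k
  | be => -l
  | beStar => l

/-- The coaction of `ℂ[u, u⁻¹]` on `O(S³_q)`: the algebra map with `α ↦ α ⊗ uᵏ`,
`β ↦ β ⊗ u⁻ˡ` (and `α* ↦ α* ⊗ u⁻ᵏ`, `β* ↦ β* ⊗ uˡ`). -/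
def coaction (q : ℝ) (k l : ℕ) : QSphere q →ₐ[ℂ] QSphere q ⊗[ℂ] ℂ[T;T⁻¹] :=
  lift (fun x => gen q x ⊗ₜ[ℂ] LaurentPolynomial.T (degree k l x)) (by
    intro x y h
    cases h
    all_goals simp only [letter, map_mul, map_add, map_smul, map_one, FreeAlgebra.lift_ι_apply,
      Algebra.TensorProduct.tmul_mul_tmul, degree, ← LaurentPolynomial.T_add, al_be, al_beStar,
      al_be_star, al_beStar_star, be_normal, add_neg_cancel, neg_add_cancel,
      LaurentPolynomial.T_zero, TensorProduct.smul_tmul']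
    · rw [add_comm]
    · rw [add_comm]
    · rw [add_comm]
    · rw [add_comm]
    · rw [al_alStar, be_normal, TensorProduct.add_tmul]
    · rw [← TensorProduct.add_tmul, ← be_normal, sphere, Algebra.TensorProduct.one_def])

@[simp] theorem coaction_gen (k l : ℕ) (x : SphereGen) :
    coaction q k l (gen q x) = gen q x ⊗ₜ[ℂ] LaurentPolynomial.T (degree k l x) :=
  lift_gen _ _ x

/-- The involution `T n ↦ T (-n)` of the Laurent polynomials, with values in the second leg. -/
def laurentStar (q : ℝ) : ℂ[T;T⁻¹] →ₐ[ℂ] ConjOp (QSphere q ⊗[ℂ] ℂ[T;T⁻¹]) :=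
  AddMonoidAlgebra.lift ℂ _ ℤ
    { toFun := fun n => ConjOp.mk ((1 : QSphere q) ⊗ₜ[ℂ] LaurentPolynomial.T (-n.toAdd))
      map_one' := by simp [← Algebra.TensorProduct.one_def]
      map_mul' := fun m n => by
        rw [← ConjOp.mk_mul, Algebra.TensorProduct.tmul_mul_tmul, ← LaurentPolynomial.T_add,
          one_mul, toAdd_mul, neg_add_rev] }

theorem laurentStar_T (n : ℤ) :
    laurentStar q (LaurentPolynomial.T n) = ConjOp.mk (1 ⊗ₜ[ℂ] LaurentPolynomial.T (-n)) := by
  unfold laurentStar LaurentPolynomial.T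
  erw [AddMonoidAlgebra.lift_single]
  rw [one_smul]
  rfl

/-- The involution of `O(S³_q) ⊗ ℂ[u, u⁻¹]`. -/
def tensorStar (q : ℝ) :
    QSphere q ⊗[ℂ] ℂ[T;T⁻¹] →ₐ[ℂ] ConjOp (QSphere q ⊗[ℂ] ℂ[T;T⁻¹]) :=
  Algebra.TensorProduct.lift
    ((ConjOp.map Algebra.TensorProduct.includeLeft).comp (starHom q)) (laurentStar q) (by
      intro x y
      induction y using LaurentPolynomial.induction_on' with
      | add p r hp hr => rw [map_add]; exact hp.add_right hr
      | C_mul_T n c =>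
        have : LaurentPolynomial.C c * LaurentPolynomial.T n
            = c • (LaurentPolynomial.T n : ℂ[T;T⁻¹]) := by
          rw [LaurentPolynomial.smul_eq_C_mul]
        rw [this, map_smul]
        refine Commute.smul_right ?_ c
        rw [laurentStar_T]
        apply ConjOp.out_injective
        simp)

theorem tensorStar_coaction (k l : ℕ) (x : QSphere q) :
    tensorStar q (coaction q k l x) = ConjOp.mk (coaction q k l (star x)) := by
  have h : (tensorStar q).comp (coaction q k l)
      = (ConjOp.map (coaction q k l)).comp (starHom q) := by
    apply hom_ext
    intro x
    apply ConjOp.out_injective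
    rw [AlgHom.comp_apply, AlgHom.comp_apply, ConjOp.out_map, starHom_gen, ConjOp.out_mk,
      coaction_gen, coaction_gen, tensorStar, Algebra.TensorProduct.lift_tmul, AlgHom.comp_apply,
      starHom_gen, laurentStar_T]
    cases x <;> simp [degree, SphereGen.inv]
  exact DFunLike.congr_fun h x

end QSphere

open QSphere SphereGen

/-- The coordinate algebra `O(WP_q(k,l))` of the quantum weighted projective line: the
`*`-subalgebra of all coaction invariant elements `x` of `O(S³_q)`, i.e. `ϱ(x) = x ⊗ 1`. -/
def WP (q : ℝ) (k l : ℕ) : StarSubalgebra ℂ (QSphere q) where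
  carrier := {x | coaction q k l x = x ⊗ₜ[ℂ] 1}
  mul_mem' {x y} hx hy := by
    simp only [Set.mem_ofPred_eq] at hx hy ⊢
    rw [map_mul, hx, hy, Algebra.TensorProduct.tmul_mul_tmul, one_mul]
  add_mem' {x y} hx hy := by
    simp only [Set.mem_ofPred_eq] at hx hy ⊢
    rw [map_add, hx, hy, TensorProduct.add_tmul]
  algebraMap_mem' c := by
    simp [Algebra.TensorProduct.algebraMap_apply]
  star_mem' {x} hx := by
    simp only [Set.mem_ofPred_eq] at hx ⊢
    have h := tensorStar_coaction k l x
    rw [hx, tensorStar, Algebra.TensorProduct.lift_tmul, map_one, mul_one] at h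
    exact (congrArg ConjOp.out h).symm

/-- The element `a = ββ*` of `O(WP_q(k,l))`. -/
def WP.a (q : ℝ) (k l : ℕ) : WP q k l :=
  ⟨gen q be * star (gen q be), by
    change coaction q k l _ = _
    rw [star_gen, map_mul, coaction_gen, coaction_gen, Algebra.TensorProduct.tmul_mul_tmul,
      ← LaurentPolynomial.T_add]
    simp [SphereGen.inv, degree]⟩

/-- The element `b = αˡβᵏ` of `O(WP_q(k,l))`. -/
def WP.b (q : ℝ) (k l : ℕ) : WP q k l :=
  ⟨gen q al ^ l * gen q be ^ k, by
    change coaction q k l _ = _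
    rw [map_mul, map_pow, map_pow, coaction_gen, coaction_gen, Algebra.TensorProduct.tmul_pow,
      Algebra.TensorProduct.tmul_pow, Algebra.TensorProduct.tmul_mul_tmul,
      LaurentPolynomial.T_pow, LaurentPolynomial.T_pow, ← LaurentPolynomial.T_add]
    have h : (l : ℤ) * degree k l al + (k : ℤ) * degree k l be = 0 := by
      simp only [degree]; ring
    rw [h, LaurentPolynomial.T_zero]⟩

/-- Integer powers of `b`, with the convention `b⁻ⁿ = (b*)ⁿ` for positive `n`. -/
def WP.bpow (q : ℝ) (k l : ℕ) (n : ℤ) : WP q k l :=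
  if 0 ≤ n then WP.b q k l ^ n.toNat else star (WP.b q k l) ^ (-n).toNat

/-! ## Representations -/

/-- The Hilbert space `l²(ℕ)`. -/
abbrev L2N := lp (fun _ : ℕ => ℂ) 2

/-- The standard orthonormal basis of `l²(ℕ)`. -/
def e (p : ℕ) : L2N := lp.single 2 p (1 : ℂ)

/-- The one-dimensional representation `π₀`, given by `a ↦ 0`, `b ↦ 0`. -/
def IsPiZero {q : ℝ} {k l : ℕ} (π₀ : WP q k l →⋆ₐ[ℂ] ℂ) : Prop :=
  π₀ (WP.a q k l) = 0 ∧ π₀ (WP.b q k l) = 0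

/-- The representation `π_s` on `l²(ℕ)`: `π_s(a) e_p = q^{2(lp+s)} e_p`,
`π_s(b) e_p = q^{k(lp+s)} ∏_{r=1}^l (1 - q^{2(lp+s-r)})^{1/2} e_{p-1}` for `p ≥ 1`, and
`π_s(b) e_0 = 0`. -/
structure IsPi {q : ℝ} {k l : ℕ} (s : ℕ) (π : WP q k l →⋆ₐ[ℂ] (L2N →L[ℂ] L2N)) : Prop where
  a_apply : ∀ p : ℕ, π (WP.a q k l) (e p) = ((q : ℂ) ^ (2 * (l * p + s))) • e p
  b_apply_succ : ∀ p : ℕ, π (WP.b q k l) (e (p + 1)) =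
    (((q ^ (k * (l * (p + 1) + s)) *
      ∏ r ∈ Finset.Icc 1 l, √(1 - q ^ (2 * (l * (p + 1) + s - r))) : ℝ) : ℂ)) • e p
  b_apply_zero : π (WP.b q k l) (e 0) = 0

/-- The countable direct sum `⊕ π₀` on `⊕ ℂ ≃ l²(ℕ)` of a one-dimensional representation:
every `x` acts on every component by the number `π₀(x)`. -/
def ampliation {A : Type*} [Ring A] [StarRing A] [Algebra ℂ A] (π₀ : A →⋆ₐ[ℂ] ℂ) :
    A →⋆ₐ[ℂ] (L2N →L[ℂ] L2N) :=
  (StarAlgHom.ofId ℂ (L2N →L[ℂ] L2N)).comp π₀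

theorem ampliation_apply {A : Type*} [Ring A] [StarRing A] [Algebra ℂ A] (π₀ : A →⋆ₐ[ℂ] ℂ)
    (x : A) (v : L2N) (i : ℕ) : (ampliation π₀ x v : ℕ → ℂ) i = π₀ x * (v : ℕ → ℂ) i := by
  change (algebraMap ℂ (L2N →L[ℂ] L2N) (π₀ x) v : ℕ → ℂ) i = _
  simp [Algebra.algebraMap_eq_smul_one]

section DirectSum

theorem double_ext {K : Type*} {v w : WithLp 2 (K × K)} (h₁ : v.fst = w.fst)
    (h₂ : v.snd = w.snd) : v = w := by
  apply (WithLp.equiv 2 (K × K)).injective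
  exact Prod.ext h₁ h₂

variable (H : Type*) [NormedAddCommGroup H] [InnerProductSpace ℂ H]

/-- The Hilbert space direct sum `H ⊕ H`. -/
abbrev Double := WithLp 2 (H × H)

variable {H}

/-- The operator on `H ⊕ H` with the block matrix `!![A, B; C, D]`. -/
def block (A B C D : H →L[ℂ] H) : Double H →L[ℂ] Double H :=
  ((WithLp.prodContinuousLinearEquiv 2 ℂ H H).symm : H × H →L[ℂ] Double H) ∘L
    (((A ∘L ContinuousLinearMap.fst ℂ H H + B ∘L ContinuousLinearMap.snd ℂ H H).prod
      (C ∘L ContinuousLinearMap.fst ℂ H H + D ∘L ContinuousLinearMap.snd ℂ H H)) ∘L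
    ((WithLp.prodContinuousLinearEquiv 2 ℂ H H) : Double H →L[ℂ] H × H))

@[simp] theorem block_apply_fst (A B C D : H →L[ℂ] H) (v : Double H) :
    (block A B C D v).fst = A v.fst + B v.snd := rfl

@[simp] theorem block_apply_snd (A B C D : H →L[ℂ] H) (v : Double H) :
    (block A B C D v).snd = C v.fst + D v.snd := rfl

variable (H) in
/-- The flip operator `F = !![0, I; I, 0]`. -/
def flipOp : Double H →L[ℂ] Double H := block 0 1 1 0

variable (H) in
/-- The grading `γ = !![I, 0; 0, -I]`. -/
def grading : Double H →L[ℂ] Double H := block 1 0 0 (-1)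

variable [CompleteSpace H]

theorem star_block_diag (A D : H →L[ℂ] H) :
    star (block A 0 0 D) = block (star A) 0 0 (star D) := by
  rw [ContinuousLinearMap.star_eq_adjoint]
  refine ((ContinuousLinearMap.eq_adjoint_iff _ _).2 fun v w => ?_).symm
  simp [WithLp.prod_inner_apply, ContinuousLinearMap.star_eq_adjoint,
    ContinuousLinearMap.adjoint_inner_left]

/-- The direct sum of two representations. -/
def directSum {A : Type*} [Ring A] [StarRing A] [Algebra ℂ A]
    (π₁ π₂ : A →⋆ₐ[ℂ] (H →L[ℂ] H)) : A →⋆ₐ[ℂ] (Double H →L[ℂ] Double H) where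
  toFun x := block (π₁ x) 0 0 (π₂ x)
  map_one' := by ext v; apply double_ext <;> simp
  map_mul' x y := by ext v; apply double_ext <;> simp
  map_zero' := by ext v; apply double_ext <;> simp
  map_add' x y := by ext v; apply double_ext <;> simp
  commutes' c := by
    ext v; apply double_ext <;> simp [Algebra.algebraMap_eq_smul_one]
  map_star' x := by rw [map_star, map_star, star_block_diag]

end DirectSum

/-! ## Trace class operators, Fredholm modules, Chern characters -/

section Fredholm

universe u v

variable {V : Type u} [NormedAddCommGroup V] [InnerProductSpace ℂ V]

/-- Trace class operators on a Hilbert space, in the form of nuclear operators: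
`T x = ∑ₙ ⟨uₙ, x⟩ vₙ` with `∑ₙ ‖uₙ‖ ‖vₙ‖ < ∞`. -/
def IsTraceClass (T : V →L[ℂ] V) : Prop :=
  ∃ u v : ℕ → V, Summable (fun n => ‖u n‖ * ‖v n‖) ∧
    ∀ x, HasSum (fun n => inner ℂ (u n) x • v n) (T x)

/-- `T` is trace class with `Tr T = t`: for every Hilbert basis `(bᵢ)` the series
`∑ᵢ ⟨bᵢ, T bᵢ⟩` converges (unconditionally) to `t`. -/
def HasTrace (T : V →L[ℂ] V) (t : ℂ) : Prop :=
  IsTraceClass T ∧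
    ∀ (ι : Type u) (b : HilbertBasis ι ℂ V), HasSum (fun i => inner ℂ (b i) (T (b i))) t

variable [CompleteSpace V] {A : Type v} [Ring A] [StarRing A] [Algebra ℂ A]

/-- `(V, π, F, γ)` is an even Fredholm module over the `*`-algebra `A`. -/
structure IsEvenFredholmModule (π : A →⋆ₐ[ℂ] (V →L[ℂ] V)) (F γ : V →L[ℂ] V) : Prop where
  F_selfAdjoint : star F = F
  F_sq : F * F = 1
  compact_commutator : ∀ x, IsCompactOperator (F * π x - π x * F)
  γ_selfAdjoint : star γ = γ
  γ_sq : γ * γ = 1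
  γ_commute : ∀ x, γ * π x = π x * γ
  γ_anticommute : γ * F = -(F * γ)

/-- 1-summability: all commutators `[F, π(x)]` are trace class. -/
def IsOneSummable (π : A →⋆ₐ[ℂ] (V →L[ℂ] V)) (F : V →L[ℂ] V) : Prop :=
  ∀ x, IsTraceClass (F * π x - π x * F)

/-- `τ` is the Chern character of the 1-summable even Fredholm module `(V, π, F, γ)`:
`τ(x) = ½ Tr(γ F [F, π(x)])`. This is the regularisation of `Tr(γ π(x))`; it equals
`Tr(γ π(x))` whenever `γ π(x)` is itself trace class (as `F² = 1` and `γF = -Fγ`), but makes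
sense for all `x` (for `x = 1`, the operator `γ π(x) = γ` is not trace class). -/
def IsChernCharacter (π : A →⋆ₐ[ℂ] (V →L[ℂ] V)) (F γ : V →L[ℂ] V) (τ : A →ₗ[ℂ] ℂ) : Prop :=
  ∀ x, HasTrace ((1 / 2 : ℂ) • (γ * F * (F * π x - π x * F))) (τ x)

end Fredholm

end QuantumTeardrop

end

open scoped TensorProduct LaurentPolynomial

namespace QuantumTeardrop

/-! ## The trace of nuclear operators -/

section NuclearTrace

variable {H K : Type*} [NormedAddCommGroup H] [InnerProductSpace ℂ H]
  [NormedAddCommGroup K] [InnerProductSpace ℂ K]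

/-! Everything rests on one fact: T(x) = π_s(x) - π₀(x)I is trace class for every x. For a diagonal
block operator diag(A, D), the commutator with F is off-diagonal with entries ±(A - D), and ½γF[F,
diag(A, D)] = ½ diag(A - D, A - D). Summability, compactness and τ_s(x) = Tr T(x) all follow
(`IsTraceClass.flipOp_commutator`, `HasTrace.grading_flipOp_commutator`).

The identity T(xy) = π_s(x)T(y) + π₀(y)T(x) and the ideal property reduce the fact to algebra
generators (`IsPi.isTraceClass_sub`). The elements a, b, b* generate (`WP.adjoin_eq_top`), since
ordered monomials span the sphere algebra, each is homogeneous for the coaction, and coprimality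
makes those of degree zero products of powers of a, b and b* up to scalars. On the generators π₀
vanishes and π_s has geometrically decaying weights.

Generation also gives uniqueness of π₀ and π_s. They exist as restrictions of representations of the
sphere: a character for π₀, and for π_s a weighted shift representation cut down to a residue class
modulo l, which b preserves because it lowers the index by l.

The trace property holds because T(xy) - T(yx) is a commutator of T(x) with a bounded operator.
Finally a^m bⁿ moves basis vectors by -n, so its diagonal vanishes unless n = 0, when the trace is a
geometric series. -/

/-- A nuclear expansion `T x = ∑ₙ ⟨uₙ, x⟩ vₙ` with `∑ₙ ‖uₙ‖ ‖vₙ‖ < ∞`. -/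
structure IsNuclearExpansion (T : H →L[ℂ] H) (u v : ℕ → H) : Prop where
  summable : Summable fun n => ‖u n‖ * ‖v n‖
  hasSum : ∀ x, HasSum (fun n => inner ℂ (u n) x • v n) (T x)

theorem isTraceClass_iff {T : H →L[ℂ] H} :
    IsTraceClass T ↔ ∃ u v, IsNuclearExpansion T u v :=
  ⟨fun ⟨u, v, h, h'⟩ => ⟨u, v, h, h'⟩, fun ⟨u, v, h⟩ => ⟨u, v, h.1, h.2⟩⟩

/-- Cauchy–Schwarz followed by Bessel's inequality; the uniform bound is what allows the order of
summation to be exchanged in the trace. -/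
theorem sum_norm_inner_mul_inner_le {ι : Type*} {b : ι → H} (hb : Orthonormal ℂ b) (x y : H)
    (s : Finset ι) : ∑ i ∈ s, ‖inner ℂ x (b i) * inner ℂ (b i) y‖ ≤ ‖x‖ * ‖y‖ := by
  have hx : √(∑ i ∈ s, ‖inner ℂ (b i) x‖ ^ 2) ≤ ‖x‖ :=
    Real.sqrt_le_iff.2 ⟨norm_nonneg _, hb.sum_inner_products_le x⟩
  have hy : √(∑ i ∈ s, ‖inner ℂ (b i) y‖ ^ 2) ≤ ‖y‖ :=
    Real.sqrt_le_iff.2 ⟨norm_nonneg _, hb.sum_inner_products_le y⟩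
  calc ∑ i ∈ s, ‖inner ℂ x (b i) * inner ℂ (b i) y‖
      = ∑ i ∈ s, ‖inner ℂ (b i) x‖ * ‖inner ℂ (b i) y‖ :=
        Finset.sum_congr rfl fun i _ => by rw [norm_mul, norm_inner_symm]
    _ ≤ √(∑ i ∈ s, ‖inner ℂ (b i) x‖ ^ 2) * √(∑ i ∈ s, ‖inner ℂ (b i) y‖ ^ 2) :=
        Real.sum_mul_le_sqrt_mul_sqrt _ _ _
    _ ≤ ‖x‖ * ‖y‖ := mul_le_mul hx hy (Real.sqrt_nonneg _) (norm_nonneg _)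

/-- The trace of a nuclear operator is `∑ₙ ⟨uₙ, vₙ⟩` for each nuclear expansion. -/
theorem IsNuclearExpansion.hasTrace {T : H →L[ℂ] H} {u v : ℕ → H}
    (h : IsNuclearExpansion T u v) : HasTrace T (∑' n, inner ℂ (u n) (v n)) := by
  refine ⟨⟨u, v, h.1, h.2⟩, fun ι b => ?_⟩
  -- This double series is absolutely summable. Summing over `i` first gives ∑ₙ ⟨uₙ, vₙ⟩ by
  -- Parseval; summing over `n` first gives ∑ᵢ ⟨bᵢ, T bᵢ⟩.
  let f : ℕ × ι → ℂ := fun p => inner ℂ (u p.1) (b p.2) * inner ℂ (b p.2) (v p.1)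
  have hf : Summable f := by
    have hle := fun n => sum_norm_inner_mul_inner_le b.orthonormal (u n) (v n)
    have h1 : ∀ n, Summable fun i => ‖f (n, i)‖ := fun n =>
      summable_of_sum_le (fun _ => norm_nonneg _) (hle n)
    refine Summable.of_norm ((summable_prod_of_nonneg fun _ => norm_nonneg _).2 ⟨h1, ?_⟩)
    exact Summable.of_nonneg_of_le (fun n => tsum_nonneg fun _ => norm_nonneg _)
      (fun n => (h1 n).tsum_le_of_sum_le (hle n)) h.1
  have h2 : HasSum (fun n => inner ℂ (u n) (v n)) (∑' p, f p) :=
    hf.hasSum.prod_fiberwise fun n => b.hasSum_inner_mul_inner (u n) (v n)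
  rw [h2.tsum_eq]
  have h3 : HasSum (f ∘ Equiv.prodComm ι ℕ) (∑' p, f p) :=
    (Equiv.hasSum_iff (Equiv.prodComm ι ℕ)).2 hf.hasSum
  refine h3.prod_fiberwise fun i => ?_
  simpa [f, inner_smul_right] using (innerSL ℂ (b i)).hasSum (h.2 (b i))

theorem IsTraceClass.exists_hasTrace {T : H →L[ℂ] H} (h : IsTraceClass T) :
    ∃ t, HasTrace T t := by
  obtain ⟨u, v, h⟩ := isTraceClass_iff.1 h
  exact ⟨_, h.hasTrace⟩

theorem HasTrace.unique [CompleteSpace H] {T : H →L[ℂ] H} {s t : ℂ} (hs : HasTrace T s)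
    (ht : HasTrace T t) : s = t := by
  obtain ⟨w, b, -⟩ := exists_hilbertBasis ℂ H
  exact (hs.2 w b).unique (ht.2 w b)

theorem IsTraceClass.add {S T : H →L[ℂ] H} (hS : IsTraceClass S) (hT : IsTraceClass T) :
    IsTraceClass (S + T) := by
  obtain ⟨u, v, h₁, h₂⟩ := hS
  obtain ⟨u', v', h₁', h₂'⟩ := hT
  let E := Equiv.natSumNatEquivNat.symm
  refine ⟨Sum.elim u u' ∘ E, Sum.elim v v' ∘ E, ?_, fun x => ?_⟩
  · exact (Equiv.summable_iff E (f := fun n => ‖Sum.elim u u' n‖ * ‖Sum.elim v v' n‖)).2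
      (HasSum.sum (f := fun n => ‖Sum.elim u u' n‖ * ‖Sum.elim v v' n‖)
        h₁.hasSum h₁'.hasSum).summable
  · exact (Equiv.hasSum_iff E
      (f := fun n => inner ℂ (Sum.elim u u' n) x • Sum.elim v v' n)).2
      (HasSum.sum (f := fun n => inner ℂ (Sum.elim u u' n) x • Sum.elim v v' n)
        (h₂ x) (h₂' x))

theorem IsTraceClass.smul (c : ℂ) {T : H →L[ℂ] H} (hT : IsTraceClass T) :
    IsTraceClass (c • T) := by
  obtain ⟨u, v, h₁, h₂⟩ := hT
  refine ⟨u, fun n => c • v n, ?_, fun x => ?_⟩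
  · simpa [norm_smul, mul_left_comm] using h₁.mul_left ‖c‖
  · simpa [smul_comm c] using (h₂ x).const_smul c

theorem isTraceClass_zero : IsTraceClass (0 : H →L[ℂ] H) :=
  ⟨0, 0, by simp, fun x => by simp⟩

theorem HasTrace.add {S T : H →L[ℂ] H} {s t : ℂ} (hS : HasTrace S s) (hT : HasTrace T t) :
    HasTrace (S + T) (s + t) :=
  ⟨hS.1.add hT.1, fun ι b => by simpa [inner_add_right] using (hS.2 ι b).add (hT.2 ι b)⟩

theorem HasTrace.smul (c : ℂ) {T : H →L[ℂ] H} {t : ℂ} (hT : HasTrace T t) :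
    HasTrace (c • T) (c * t) :=
  ⟨hT.1.smul c, fun ι b => by simpa [inner_smul_right] using (hT.2 ι b).mul_left c⟩

theorem HasTrace.sub {S T : H →L[ℂ] H} {s t : ℂ} (hS : HasTrace S s) (hT : HasTrace T t) :
    HasTrace (S - T) (s - t) := by
  simpa [sub_eq_add_neg] using hS.add (hT.smul (-1))

/-! ### Ideal property, cyclicity and compactness. -/

section Ideal

variable [CompleteSpace H] [CompleteSpace K]

theorem IsNuclearExpansion.comp {T : H →L[ℂ] H} {u v : ℕ → H} (h : IsNuclearExpansion T u v)
    (J : H →L[ℂ] K) (P : K →L[ℂ] H) :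
    IsNuclearExpansion (J ∘L T ∘L P) (fun n => P.adjoint (u n)) (fun n => J (v n)) := by
  refine ⟨?_, fun x => ?_⟩
  · refine Summable.of_nonneg_of_le (fun n => by positivity) (fun n => ?_)
      (h.summable.mul_left (‖P.adjoint‖ * ‖J‖))
    calc ‖P.adjoint (u n)‖ * ‖J (v n)‖ ≤ (‖P.adjoint‖ * ‖u n‖) * (‖J‖ * ‖v n‖) := by
          gcongr <;> exact ContinuousLinearMap.le_opNorm _ _
      _ = _ := by ring
  · simpa [ContinuousLinearMap.adjoint_inner_left] using J.hasSum (h.hasSum (P x))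

/-- Cyclicity of the trace. -/
theorem IsTraceClass.exists_hasTrace_cyclic {T : H →L[ℂ] H} (h : IsTraceClass T)
    (J : H →L[ℂ] K) (P : K →L[ℂ] H) :
    ∃ t, HasTrace (J ∘L T ∘L P) t ∧ HasTrace (T ∘L (P ∘L J)) t := by
  obtain ⟨u, v, h⟩ := isTraceClass_iff.1 h
  refine ⟨_, (h.comp J P).hasTrace, ?_⟩
  -- Moving adjoints across the inner product turns both traces into the same series ∑ₙ ⟨uₙ, P J
  -- vₙ⟩.
  have h' := (h.comp (ContinuousLinearMap.id ℂ H) (P ∘L J)).hasTrace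
  simpa [ContinuousLinearMap.adjoint_inner_left] using h'

theorem IsTraceClass.mul_left {T : H →L[ℂ] H} (h : IsTraceClass T) (S : H →L[ℂ] H) :
    IsTraceClass (S * T) := by
  obtain ⟨t, ht, -⟩ := h.exists_hasTrace_cyclic S 1
  exact ht.1

/-- Cyclicity turns J T P into T(PJ) = T. It serves to embed H in H ⊕ H and to conjugate by F. -/
theorem HasTrace.comp_of_leftInverse {T : H →L[ℂ] H} {t : ℂ} (h : HasTrace T t)
    {J : H →L[ℂ] K} {P : K →L[ℂ] H} (hPJ : P ∘L J = 1) : HasTrace (J ∘L T ∘L P) t := by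
  obtain ⟨t', h₁, h₂⟩ := h.1.exists_hasTrace_cyclic J P
  rw [hPJ] at h₂
  rwa [h.unique h₂]

theorem HasTrace.commutator {T S : H →L[ℂ] H} (h : IsTraceClass T) :
    HasTrace (S * T - T * S) 0 := by
  obtain ⟨t, h₁, h₂⟩ := h.exists_hasTrace_cyclic S 1
  simpa using! h₁.sub h₂

/-- The nuclear expansion is an absolutely convergent series of rank-one operators, and compact
operators are closed in norm. -/
theorem IsTraceClass.isCompactOperator {T : H →L[ℂ] H} (h : IsTraceClass T) :
    IsCompactOperator T := by
  obtain ⟨u, v, h₁, h₂⟩ := h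
  let R : ℕ → H →L[ℂ] H := fun n => InnerProductSpace.rankOne ℂ (v n) (u n)
  have hR : Summable R := Summable.of_norm (by simpa [R, mul_comm] using h₁)
  have hT : T = ∑' n, R n := by
    ext x
    refine (h₂ x).unique ?_
    exact hR.hasSum.mapL (ContinuousLinearMap.apply ℂ H x)
  have hc : T ∈ {f : H →L[ℂ] H | IsCompactOperator f} := by
    refine isClosed_setOfPred_isCompactOperator.mem_of_tendsto (hT ▸ hR.hasSum)
      (Filter.Eventually.of_forall fun s => ?_)
    refine Submodule.sum_mem (compactOperator (RingHom.id ℂ) H H) fun n _ => ?_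
    exact (isCompactOperator_of_locallyCompactSpace_dom (innerSL ℂ (u n))).clm_comp
      (ContinuousLinearMap.toSpanSingleton ℂ (v n))
  exact hc

end Ideal

/-- Expanding x in the basis gives T x = ∑ ⟨bₙ, x⟩ T bₙ, which is already a nuclear expansion. -/
theorem HilbertBasis.isTraceClass (b : HilbertBasis ℕ ℂ H) {T : H →L[ℂ] H}
    (h : Summable fun n => ‖T (b n)‖) : IsTraceClass T := by
  refine ⟨b, fun n => T (b n), by simpa [b.orthonormal.norm_eq_one] using h, fun x => ?_⟩
  simpa [b.repr_apply_apply] using T.hasSum (b.hasSum_repr x)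

end NuclearTrace

/-! ### Block operators on H ⊕ H and their traces. -/

section Blocks

variable {H : Type*} [NormedAddCommGroup H] [InnerProductSpace ℂ H]

/-- The first inclusion of `H` in `H ⊕ H`. -/
noncomputable def inlOp (H : Type*) [NormedAddCommGroup H] [InnerProductSpace ℂ H] :
    H →L[ℂ] Double H :=
  (WithLp.prodContinuousLinearEquiv 2 ℂ H H).symm ∘L ContinuousLinearMap.inl ℂ H H

/-- The first projection of `H ⊕ H`. -/
noncomputable def fstOp (H : Type*) [NormedAddCommGroup H] [InnerProductSpace ℂ H] :
    Double H →L[ℂ] H :=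
  ContinuousLinearMap.fst ℂ H H ∘L (WithLp.prodContinuousLinearEquiv 2 ℂ H H)

theorem block_ext {S T : Double H →L[ℂ] Double H} (h₁ : ∀ v, (S v).fst = (T v).fst)
    (h₂ : ∀ v, (S v).snd = (T v).snd) : S = T :=
  ContinuousLinearMap.ext fun v => double_ext (h₁ v) (h₂ v)

theorem block_mul (A B C D A' B' C' D' : H →L[ℂ] H) :
    block A B C D * block A' B' C' D' =
      block (A * A' + B * C') (A * B' + B * D') (C * A' + D * C') (C * B' + D * D') := by
  apply block_ext <;> intro v <;> simp <;> abel

theorem block_sub (A B C D A' B' C' D' : H →L[ℂ] H) :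
    block A B C D - block A' B' C' D' = block (A - A') (B - B') (C - C') (D - D') := by
  apply block_ext <;> intro v <;> simp <;> abel

theorem block_neg (A B C D : H →L[ℂ] H) :
    -block A B C D = block (-A) (-B) (-C) (-D) := by
  apply block_ext <;> intro v <;> simp <;> abel

theorem block_one : block (1 : H →L[ℂ] H) 0 0 1 = 1 := by
  apply block_ext <;> intro v <;> simp

theorem flipOp_mul_flipOp : flipOp H * flipOp H = 1 := by
  simp [flipOp, block_mul, block_one]

theorem grading_mul_grading : grading H * grading H = 1 := by
  simp [grading, block_mul, block_one]

theorem grading_mul_flipOp : grading H * flipOp H = -(flipOp H * grading H) := by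
  simp [grading, flipOp, block_mul, block_neg]

theorem flipOp_commutator (A D : H →L[ℂ] H) :
    flipOp H * block A 0 0 D - block A 0 0 D * flipOp H = block 0 (D - A) (A - D) 0 := by
  simp [flipOp, block_mul, block_sub]

variable [CompleteSpace H]

theorem HasTrace.block_left {T : H →L[ℂ] H} {t : ℂ} (h : HasTrace T t) :
    HasTrace (block T 0 0 0) t := by
  have h' := h.comp_of_leftInverse (J := inlOp H) (P := fstOp H) (by ext; rfl)
  convert h' using 1
  apply block_ext <;> intro v <;> simp [inlOp, fstOp]

/-- diag(T, T) = diag(T, 0) + F diag(T, 0) F, and conjugation by the involution F preserves the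
trace. -/
theorem HasTrace.block_diag {T : H →L[ℂ] H} {t : ℂ} (h : HasTrace T t) :
    HasTrace (block T 0 0 T) (2 * t) := by
  have hF : flipOp H ∘L flipOp H = 1 := by
    apply block_ext <;> intro v <;> simp [flipOp]
  have h' := h.block_left.add (h.block_left.comp_of_leftInverse hF)
  rw [two_mul]
  convert h' using 1
  apply block_ext <;> intro v <;> simp [flipOp]

theorem star_grading : star (grading H) = grading H := by
  simp [grading, star_block_diag]

theorem star_flipOp : star (flipOp H) = flipOp H := by
  rw [ContinuousLinearMap.star_eq_adjoint]
  refine ((ContinuousLinearMap.eq_adjoint_iff _ _).2 fun v w => ?_).symm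
  simp [flipOp, WithLp.prod_inner_apply, add_comm]

theorem IsTraceClass.flipOp_commutator {A D : H →L[ℂ] H} (h : IsTraceClass (A - D)) :
    IsTraceClass (flipOp H * block A 0 0 D - block A 0 0 D * flipOp H) := by
  obtain ⟨t, ht⟩ := h.exists_hasTrace
  -- The commutator is this bounded block times diag(A - D, A - D).
  have := ht.block_diag.1.mul_left (block 0 (-1) 1 0)
  rw [QuantumTeardrop.flipOp_commutator]
  simpa [block_mul] using this

theorem HasTrace.grading_flipOp_commutator {A D : H →L[ℂ] H} {t : ℂ}
    (h : HasTrace (A - D) t) :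
    HasTrace ((1 / 2 : ℂ) • (grading H * flipOp H *
      (flipOp H * block A 0 0 D - block A 0 0 D * flipOp H))) t := by
  have := h.block_diag.smul (1 / 2)
  rw [flipOp_commutator]
  simpa [grading, flipOp, block_mul] using this

end Blocks

/-! ## Generators of the quantum weighted projective line -/

section SkewCommute

variable {A : Type*} [Ring A] [Algebra ℂ A] {x y : A} {c : ℂ}

theorem mul_pow_eq_smul_of_mul_eq_smul (h : x * y = c • (y * x)) (n : ℕ) :
    x * y ^ n = c ^ n • (y ^ n * x) := by
  induction n with
  | zero => simp
  | succ n ih =>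
    rw [pow_succ, ← mul_assoc, ih, smul_mul_assoc, mul_assoc, h, mul_smul_comm, smul_smul,
      ← mul_assoc, pow_succ]

theorem mul_eq_inv_smul_of_mul_eq_smul (hc : c ≠ 0) (h : x * y = c • (y * x)) :
    y * x = c⁻¹ • (x * y) := by
  rw [h, smul_smul, inv_mul_cancel₀ hc, one_smul]

theorem pow_mul_pow_eq_smul_of_mul_eq_smul (h : x * y = c • (y * x)) (m n : ℕ) :
    x ^ m * y ^ n = (c ^ n) ^ m • (y ^ n * x ^ m) := by
  induction m with
  | zero => simp
  | succ m ih =>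
    rw [pow_succ', mul_assoc, ih, mul_smul_comm, ← mul_assoc,
      mul_pow_eq_smul_of_mul_eq_smul h, smul_mul_assoc, smul_smul, mul_assoc, pow_succ]

/-- Moving one y to the left through xⁿ splits off a factor xy at the cost of a scalar. With x = αˡ
and y = βᵏ this produces powers of b. -/
theorem pow_mul_pow_mem_of_mul_eq_smul (h : x * y = c • (y * x)) {S : Subalgebra ℂ A}
    (hS : x * y ∈ S) (n : ℕ) : x ^ n * y ^ n ∈ S := by
  induction n with
  | zero => simp [S.one_mem]
  | succ n ih =>
    have : x ^ (n + 1) * y ^ (n + 1) = c ^ n • ((x * y) * (x ^ n * y ^ n)) := by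
      have h' := pow_mul_pow_eq_smul_of_mul_eq_smul h n 1
      rw [pow_one, pow_one] at h'
      rw [pow_succ', pow_succ', mul_assoc x, ← mul_assoc (x ^ n), h']
      simp [mul_assoc]
    rw [this]
    exact S.smul_mem (S.mul_mem hS ih) _

end SkewCommute

/-! ### Ordered monomials and their degrees. -/

namespace QSphere

open SphereGen

variable {q : ℝ}

theorem induction {P : QSphere q → Prop} (algebraMap : ∀ c, P (algebraMap ℂ _ c))
    (gen : ∀ x, P (gen q x)) (add : ∀ x y, P x → P y → P (x + y))
    (mul : ∀ x y, P x → P y → P (x * y)) (x : QSphere q) : P x := by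
  obtain ⟨y, rfl⟩ := RingQuot.mkAlgHom_surjective ℂ (SphereRel q) x
  induction y using FreeAlgebra.induction with
  | grade0 c => simpa only [AlgHom.commutes] using! algebraMap c
  | grade1 x => exact gen x
  | mul x y hx hy => simpa only [map_mul] using! mul _ _ hx hy
  | add x y hx hy => simpa only [map_add] using! add _ _ hx hy

/-- The scalar 1 is kept explicit so that this product and `alStar_mul_al` share the shape used in
`IsAlpha.exists_mul_inv`. -/
theorem al_mul_alStar : gen q al * gen q alStar = 1 - (1 : ℂ) • (gen q be * gen q beStar) := by
  rw [one_smul, eq_sub_iff_add_eq, sphere]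

theorem alStar_mul_al : gen q alStar * gen q al =
    1 - ((q : ℂ) ^ (-2 : ℤ)) • (gen q be * gen q beStar) := by
  have h := al_alStar (q := q)
  rw [al_mul_alStar, ← sub_eq_iff_eq_add] at h
  rw [← h, sub_smul, one_smul]
  abel

/-- The letters `α` and `α*`. -/
def IsAlpha (x : SphereGen) : Prop := x = al ∨ x = alStar

/-- The letters `β` and `β*`. -/
def IsBeta (x : SphereGen) : Prop := x = be ∨ x = beStar

theorem isAlpha_or_isBeta (x : SphereGen) : IsAlpha x ∨ IsBeta x := by
  cases x <;> simp [IsAlpha, IsBeta]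

theorem IsBeta.exists_mul_eq_smul (hq : q ≠ 0) {x y : SphereGen} (hx : IsBeta x)
    (hy : IsAlpha y) : ∃ c : ℂ, gen q x * gen q y = c • (gen q y * gen q x) := by
  have hq' : (q : ℂ) ≠ 0 := by exact_mod_cast hq
  rcases hx with rfl | rfl <;> rcases hy with rfl | rfl
  · exact ⟨_, mul_eq_inv_smul_of_mul_eq_smul hq' al_be⟩
  · exact ⟨_, al_beStar_star⟩
  · exact ⟨_, mul_eq_inv_smul_of_mul_eq_smul hq' al_beStar⟩
  · exact ⟨_, al_be_star⟩

theorem IsAlpha.exists_mul_eq_smul (hq : q ≠ 0) {x y : SphereGen} (hx : IsAlpha x)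
    (hy : IsBeta y) : ∃ c : ℂ, gen q x * gen q y = c • (gen q y * gen q x) := by
  have hq' : (q : ℂ) ≠ 0 := by exact_mod_cast hq
  rcases hx with rfl | rfl <;> rcases hy with rfl | rfl
  · exact ⟨_, al_be⟩
  · exact ⟨_, al_beStar⟩
  · exact ⟨_, mul_eq_inv_smul_of_mul_eq_smul hq' al_beStar_star⟩
  · exact ⟨_, mul_eq_inv_smul_of_mul_eq_smul hq' al_be_star⟩

theorem IsAlpha.exists_mul_inv {x : SphereGen} (hx : IsAlpha x) :
    ∃ c : ℂ, gen q x * gen q x.inv = 1 - c • (gen q be * gen q beStar) := by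
  rcases hx with rfl | rfl
  · exact ⟨_, al_mul_alStar⟩
  · exact ⟨_, alStar_mul_al⟩

/-- The ordered monomials `αⁱ βʲ β*ᵐ` and `α*ⁱ βʲ β*ᵐ`. -/
def orderedMonomials (q : ℝ) : Set (QSphere q) :=
  {y | ∃ x, IsAlpha x ∧ ∃ i j m : ℕ, y = gen q x ^ i * (gen q be ^ j * gen q beStar ^ m)}

theorem orderedMonomial_mem {x : SphereGen} (hx : IsAlpha x) (i j m : ℕ) :
    gen q x ^ i * (gen q be ^ j * gen q beStar ^ m) ∈
      Submodule.span ℂ (orderedMonomials q) :=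
  Submodule.subset_span ⟨x, hx, i, j, m, rfl⟩

/-- A β-letter passes the α-power up to a scalar and then joins the commuting β-letters. -/
theorem IsBeta.mul_mem (hq : q ≠ 0) {z : SphereGen} (hz : IsBeta z) {y : QSphere q}
    (hy : y ∈ Submodule.span ℂ (orderedMonomials q)) :
    gen q z * y ∈ Submodule.span ℂ (orderedMonomials q) := by
  induction hy using Submodule.span_induction with
  | zero => simp
  | add u v _ _ hu hv => rw [mul_add]; exact add_mem hu hv
  | smul c u _ hu => rw [mul_smul_comm]; exact Submodule.smul_mem _ _ hu
  | mem u hu =>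
    obtain ⟨x, hx, i, j, m, rfl⟩ := hu
    obtain ⟨c, hc⟩ := hz.exists_mul_eq_smul hq hx
    rw [← mul_assoc, mul_pow_eq_smul_of_mul_eq_smul hc, smul_mul_assoc, mul_assoc]
    refine Submodule.smul_mem _ _ ?_
    rcases hz with rfl | rfl
    · rw [← mul_assoc (gen q be), ← pow_succ']
      exact orderedMonomial_mem hx _ _ _
    · have h : Commute (gen q beStar) (gen q be) := be_normal.symm
      rw [← mul_assoc (gen q beStar), (h.pow_right j).eq, mul_assoc, ← pow_succ']
      exact orderedMonomial_mem hx _ _ _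

/-- An α-letter either lengthens the α-power or meets its adjoint; in that case the pair becomes 1 -
cββ*, and the new β-letters are absorbed by `IsBeta.mul_mem`. -/
theorem IsAlpha.mul_mem (hq : q ≠ 0) {z : SphereGen} (hz : IsAlpha z) {y : QSphere q}
    (hy : y ∈ Submodule.span ℂ (orderedMonomials q)) :
    gen q z * y ∈ Submodule.span ℂ (orderedMonomials q) := by
  induction hy using Submodule.span_induction with
  | zero => simp
  | add u v _ _ hu hv => rw [mul_add]; exact add_mem hu hv
  | smul c u _ hu => rw [mul_smul_comm]; exact Submodule.smul_mem _ _ hu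
  | mem u hu =>
    obtain ⟨x, hx, i, j, m, rfl⟩ := hu
    -- With exponent 0 the letter `x` is irrelevant, so the monomial may be restarted with `z`.
    rcases i with _ | i
    · simpa using orderedMonomial_mem hz 1 j m
    have hxz : x = z ∨ x = z.inv := by
      rcases hx with rfl | rfl <;> rcases hz with rfl | rfl <;> simp [SphereGen.inv]
    rcases hxz with rfl | rfl
    · rw [← mul_assoc, ← pow_succ']
      exact orderedMonomial_mem hx _ _ _
    · obtain ⟨c, hc⟩ := hz.exists_mul_inv (q := q)
      rw [pow_succ', mul_assoc, ← mul_assoc, hc, sub_mul, one_mul, smul_mul_assoc, mul_assoc]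
      have hm := orderedMonomial_mem (q := q) hx i j m
      exact sub_mem hm (Submodule.smul_mem _ _
        (IsBeta.mul_mem hq (.inl rfl) (IsBeta.mul_mem hq (.inr rfl) hm)))

/-- The span contains 1 and is stable under left multiplication by every letter, hence by the whole
algebra. -/
theorem span_orderedMonomials (hq : q ≠ 0) : Submodule.span ℂ (orderedMonomials q) = ⊤ := by
  have h : ∀ x y : QSphere q, y ∈ Submodule.span ℂ (orderedMonomials q) →
      x * y ∈ Submodule.span ℂ (orderedMonomials q) := by
    intro x
    induction x using QSphere.induction with
    | algebraMap c =>
      intro y hy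
      rw [← Algebra.smul_def]
      exact Submodule.smul_mem _ _ hy
    | gen x => exact fun y hy => (isAlpha_or_isBeta x).elim (·.mul_mem hq hy) (·.mul_mem hq hy)
    | add u v hu hv => exact fun y hy => by rw [add_mul]; exact add_mem (hu y hy) (hv y hy)
    | mul u v hu hv => exact fun y hy => by rw [mul_assoc]; exact hu _ (hv _ hy)
  refine eq_top_iff.2 fun x _ => ?_
  simpa using h x 1 (by simpa using orderedMonomial_mem (q := q) (.inl rfl) 0 0 0)

/-- The projection of `O(S³_q)` onto its coaction invariant part. -/
noncomputable def invariantPart (q : ℝ) (k l : ℕ) : QSphere q →ₗ[ℂ] QSphere q :=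
  (TensorProduct.rid ℂ (QSphere q)).toLinearMap ∘ₗ
    (LinearMap.lTensor (QSphere q)
      (Finsupp.lapply 0 ∘ₗ (AddMonoidAlgebra.coeffLinearEquiv ℂ).toLinearMap)) ∘ₗ
    (coaction q k l).toLinearMap

theorem invariantPart_of_coaction {k l : ℕ} {x : QSphere q} {n : ℤ}
    (h : coaction q k l x = x ⊗ₜ[ℂ] LaurentPolynomial.T n) :
    invariantPart q k l x = if n = 0 then x else 0 := by
  have : invariantPart q k l x = ((LaurentPolynomial.T n : ℂ[T;T⁻¹]).coeff 0) • x := by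
    simp [invariantPart, h]
  rw [this, LaurentPolynomial.T_apply]
  split_ifs <;> simp

theorem coaction_orderedMonomial (k l : ℕ) (x : SphereGen) (i j m : ℕ) :
    coaction q k l (gen q x ^ i * (gen q be ^ j * gen q beStar ^ m)) =
      (gen q x ^ i * (gen q be ^ j * gen q beStar ^ m)) ⊗ₜ[ℂ]
        LaurentPolynomial.T (i * degree k l x + (j * -l + m * l)) := by
  simp only [map_mul, map_pow, coaction_gen, Algebra.TensorProduct.tmul_pow,
    Algebra.TensorProduct.tmul_mul_tmul, LaurentPolynomial.T_pow, ← LaurentPolynomial.T_add,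
    degree]

variable {k l : ℕ}

theorem pow_alpha_mul_pow_beta_mem (hq : q ≠ 0) {S : Subalgebra ℂ (QSphere q)}
    (hb : gen q al ^ l * gen q be ^ k ∈ S) (hb' : gen q beStar ^ k * gen q alStar ^ l ∈ S)
    (t : ℕ) : gen q al ^ (l * t) * gen q be ^ (k * t) ∈ S ∧
      gen q alStar ^ (l * t) * gen q beStar ^ (k * t) ∈ S := by
  obtain ⟨c, hc⟩ := IsAlpha.exists_mul_eq_smul hq (.inl rfl) (.inl rfl)
  obtain ⟨d, hd⟩ := IsAlpha.exists_mul_eq_smul hq (.inr rfl) (.inr rfl)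
  simp only [pow_mul]
  refine ⟨pow_mul_pow_mem_of_mul_eq_smul (pow_mul_pow_eq_smul_of_mul_eq_smul hc l k) hb t,
    pow_mul_pow_mem_of_mul_eq_smul (pow_mul_pow_eq_smul_of_mul_eq_smul hd l k) ?_ t⟩
  -- The adjoint b* has its β-letters on the left, so they are exchanged up to a scalar.
  rw [pow_mul_pow_eq_smul_of_mul_eq_smul hd l k]
  exact S.smul_mem hb' _

/-- Degree zero reads ik = l(j - m) for α and ik = l(m - j) for α*. Coprimality forces i = lt, so
the β-exponents differ by kt; pairing the surplus with the α-power leaves a power of ββ*. -/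
theorem orderedMonomial_mem_of_degree (hq : q ≠ 0) (hl : 0 < l) (hkl : k.Coprime l)
    {S : Subalgebra ℂ (QSphere q)} (ha : gen q be * gen q beStar ∈ S)
    (hb : gen q al ^ l * gen q be ^ k ∈ S) (hb' : gen q beStar ^ k * gen q alStar ^ l ∈ S)
    {x : SphereGen} (hx : IsAlpha x) {i j m : ℕ}
    (h : (i * degree k l x + (j * -l + m * l) : ℤ) = 0) :
    gen q x ^ i * (gen q be ^ j * gen q beStar ^ m) ∈ S := by
  have hdvd : l ∣ i := by
    refine hkl.symm.dvd_of_dvd_mul_right (Int.natCast_dvd_natCast.1 ?_)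
    rcases hx with rfl | rfl
    · exact ⟨j - m, by push_cast; simp only [degree] at h; linarith⟩
    · exact ⟨m - j, by push_cast; simp only [degree] at h; linarith⟩
  obtain ⟨t, rfl⟩ := hdvd
  have hl' : (l : ℤ) ≠ 0 := by exact_mod_cast hl.ne'
  have hcomm : Commute (gen q be) (gen q beStar) := be_normal
  obtain ⟨h₁, h₂⟩ := pow_alpha_mul_pow_beta_mem hq hb hb' t
  rcases hx with rfl | rfl
  · have hj : j = k * t + m := by
      apply Nat.cast_injective (R := ℤ)
      apply mul_left_cancel₀ hl'
      push_cast
      simp only [degree] at h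
      push_cast at h
      linarith
    rw [hj, pow_add, mul_assoc, ← hcomm.mul_pow, ← mul_assoc]
    exact S.mul_mem h₁ (S.pow_mem ha _)
  · have hm : m = k * t + j := by
      apply Nat.cast_injective (R := ℤ)
      apply mul_left_cancel₀ hl'
      push_cast
      simp only [degree] at h
      push_cast at h
      linarith
    rw [hm, pow_add, ← mul_assoc (gen q be ^ j), (hcomm.pow_pow j (k * t)).eq, mul_assoc,
      ← hcomm.mul_pow, ← mul_assoc]
    exact S.mul_mem h₂ (S.pow_mem ha _)

end QSphere

open QSphere SphereGen

/-! ### Generation by a, b and b*. -/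

namespace WP

variable {q : ℝ} {k l : ℕ}

theorem adjoin_eq_top (hq : q ≠ 0) (hl : 0 < l) (hkl : k.Coprime l) :
    Algebra.adjoin ℂ {a q k l, b q k l, star (b q k l)} = ⊤ := by
  set S := Algebra.adjoin ℂ {a q k l, b q k l, star (b q k l)} with hS
  let S' : Subalgebra ℂ (QSphere q) := S.map (WP q k l).toSubalgebra.val
  have mem : ∀ x ∈ S, (x : QSphere q) ∈ S' := fun x hx => ⟨x, hx, rfl⟩
  have ha := mem _ (Algebra.subset_adjoin (.inl rfl) : a q k l ∈ S)
  have hb := mem _ (Algebra.subset_adjoin (.inr (.inl rfl)) : b q k l ∈ S)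
  have hb' := mem _ (Algebra.subset_adjoin (.inr (.inr rfl)) : star (b q k l) ∈ S)
  simp only [a, star_gen, SphereGen.inv] at ha
  simp only [b] at hb
  simp only [b, StarMemClass.coe_star, star_mul, star_pow, star_gen, SphereGen.inv] at hb'
  -- The projection discards monomials of nonzero degree, so linear independence of the ordered
  -- monomials is not needed.
  have key : ∀ x : QSphere q, invariantPart q k l x ∈ S' := by
    intro x
    have hx : x ∈ Submodule.span ℂ (orderedMonomials q) := by
      rw [span_orderedMonomials hq]; trivial
    induction hx using Submodule.span_induction with
    | zero => simp [S'.zero_mem]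
    | add u v _ _ hu hv => rw [map_add]; exact S'.add_mem hu hv
    | smul c u _ hu => rw [map_smul]; exact S'.smul_mem hu c
    | mem u hu =>
      obtain ⟨x, hx, i, j, m, rfl⟩ := hu
      rw [invariantPart_of_coaction (coaction_orderedMonomial k l x i j m)]
      split_ifs with h
      · exact orderedMonomial_mem_of_degree hq hl hkl ha hb hb' hx h
      · exact S'.zero_mem
  refine eq_top_iff.2 fun x _ => ?_
  have hx : coaction q k l (x : QSphere q) = (x : QSphere q) ⊗ₜ[ℂ] LaurentPolynomial.T 0 := by
    rw [LaurentPolynomial.T_zero]; exact x.2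
  obtain ⟨y, hy, hyx⟩ := key x
  rw [invariantPart_of_coaction hx, if_pos rfl] at hyx
  rwa [← Subtype.ext (a1 := y) hyx]

theorem induction (hq : q ≠ 0) (hl : 0 < l) (hkl : k.Coprime l) {P : WP q k l → Prop}
    (algebraMap : ∀ c, P (algebraMap ℂ _ c)) (a : P (a q k l)) (b : P (b q k l))
    (star_b : P (star (WP.b q k l))) (add : ∀ x y, P x → P y → P (x + y))
    (mul : ∀ x y, P x → P y → P (x * y)) (x : WP q k l) : P x := by
  have hx : x ∈ Algebra.adjoin ℂ {WP.a q k l, WP.b q k l, star (WP.b q k l)} := by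
    rw [adjoin_eq_top hq hl hkl]; trivial
  induction hx using Algebra.adjoin_induction with
  | mem x hx => rcases hx with rfl | rfl | rfl <;> assumption
  | algebraMap c => exact algebraMap c
  | add x y _ _ hx hy => exact add x y hx hy
  | mul x y _ _ hx hy => exact mul x y hx hy

theorem starAlgHom_ext (hq : q ≠ 0) (hl : 0 < l) (hkl : k.Coprime l) {B : Type*} [Ring B]
    [StarRing B] [Algebra ℂ B] {f g : WP q k l →⋆ₐ[ℂ] B} (ha : f (a q k l) = g (a q k l))
    (hb : f (b q k l) = g (b q k l)) : f = g := by
  refine StarAlgHom.ext fun x => ?_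
  induction x using WP.induction hq hl hkl with
  | algebraMap c => rw [AlgHomClass.commutes, AlgHomClass.commutes]
  | a => exact ha
  | b => exact hb
  | star_b => rw [map_star, map_star, hb]
  | add x y hx hy => rw [map_add, map_add, hx, hy]
  | mul x y hx hy => rw [map_mul, map_mul, hx, hy]

end WP

/-! ## Weighted composition operators on `l²(ℕ)` -/

section L2N

/-- The standard basis of `l²(ℕ)` as a Hilbert basis. -/
noncomputable def eBasis : HilbertBasis ℕ ℂ L2N :=
  HilbertBasis.ofRepr (LinearIsometryEquiv.refl ℂ L2N)

theorem eBasis_apply (p : ℕ) : eBasis p = e p :=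
  (eBasis.repr_symm_single p).symm

theorem norm_e (p : ℕ) : ‖e p‖ = 1 := by
  rw [← eBasis_apply, eBasis.orthonormal.norm_eq_one]

theorem e_apply (p n : ℕ) : (e p : ℕ → ℂ) n = if n = p then 1 else 0 := by
  simp [e, Pi.single_apply]

theorem inner_e_left (p : ℕ) (v : L2N) : inner ℂ (e p) v = (v : ℕ → ℂ) p := by
  rw [e, lp.inner_single_left]; simp

theorem ext_e {E : Type*} [NormedAddCommGroup E] [NormedSpace ℂ E] {S T : L2N →L[ℂ] E}
    (h : ∀ p, S (e p) = T (e p)) : S = T := by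
  refine ContinuousLinearMap.ext_on (s := Set.range eBasis) ?_ ?_
  · rw [Submodule.dense_iff_topologicalClosure_eq_top]
    exact eBasis.dense_span
  · rintro _ ⟨p, rfl⟩
    rw [eBasis_apply, h]

variable (w : ℕ → ℂ) (σ : ℕ → ℕ) (hw : ∀ n, ‖w n‖ ≤ 1) (hσ : Function.Injective σ)

include hw hσ in
-- Injectivity of `σ` means no coordinate is counted twice. The bound yields both membership in ℓ²
-- and continuity.
theorem sum_norm_weightedComp_le (v : L2N) (s : Finset ℕ) :
    ∑ n ∈ s, ‖w n * (v : ℕ → ℂ) (σ n)‖ ^ (2 : ENNReal).toReal ≤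
      ‖v‖ ^ (2 : ENNReal).toReal := by
  calc ∑ n ∈ s, ‖w n * (v : ℕ → ℂ) (σ n)‖ ^ (2 : ENNReal).toReal
      ≤ ∑ n ∈ s, ‖(v : ℕ → ℂ) (σ n)‖ ^ (2 : ENNReal).toReal := by
        refine Finset.sum_le_sum fun n _ => ?_
        gcongr
        rw [norm_mul]
        exact mul_le_of_le_one_left (norm_nonneg _) (hw n)
    _ = ∑ n ∈ s.map ⟨σ, hσ⟩, ‖(v : ℕ → ℂ) n‖ ^ (2 : ENNReal).toReal := by simp
    _ ≤ _ := lp.sum_rpow_le_norm_rpow (by simp) v _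

/-- The weighted composition operator `v ↦ (n ↦ wₙ v_{σ(n)})`. -/
noncomputable def weightedComp : L2N →L[ℂ] L2N :=
  LinearMap.mkContinuous
    { toFun := fun v => ⟨fun n => w n * (v : ℕ → ℂ) (σ n),
        memℓp_gen' (sum_norm_weightedComp_le w σ hw hσ v)⟩
      map_add' := fun u v => by ext n; exact mul_add _ _ _
      map_smul' := fun c v => by ext n; simp [mul_left_comm] } 1 fun v => by
    rw [one_mul]
    exact lp.norm_le_of_forall_sum_le (by simp) (norm_nonneg _)
      (sum_norm_weightedComp_le w σ hw hσ v)

theorem weightedComp_apply (v : L2N) (n : ℕ) :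
    (weightedComp w σ hw hσ v : ℕ → ℂ) n = w n * (v : ℕ → ℂ) (σ n) := rfl

theorem weightedComp_e (p : ℕ) : weightedComp w σ hw hσ (e (σ p)) = w p • e p := by
  ext n
  by_cases h : n = p
  · simp [weightedComp_apply, e_apply, h]
  · simp [weightedComp_apply, e_apply, hσ.eq_iff, h]

theorem weightedComp_e_of_forall_ne {j : ℕ} (h : ∀ p, σ p ≠ j) :
    weightedComp w σ hw hσ (e j) = 0 := by
  ext n
  simp [weightedComp_apply, e_apply, h n]

theorem star_weightedComp_e (p : ℕ) :
    star (weightedComp w σ hw hσ) (e p) = starRingEnd ℂ (w p) • e (σ p) := by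
  ext n
  rw [← inner_e_left, ContinuousLinearMap.star_eq_adjoint,
    ContinuousLinearMap.adjoint_inner_right, ← inner_conj_symm, inner_e_left,
    weightedComp_apply]
  by_cases h : σ p = n
  · simp [e_apply, h]
  · simp [e_apply, h, Ne.symm h]

end L2N

/-! ## The representation of the quantum sphere on `l²(ℕ)` -/

namespace QSphere

open SphereGen

/-- The weights of the shift that represents `α`. -/
noncomputable def alphaWeight (q : ℝ) (n : ℕ) : ℂ := ((√(1 - q ^ (2 * (n + 1))) : ℝ) : ℂ)

variable {q : ℝ}

theorem alphaWeight_mul_self (hq0 : 0 < q) (hq1 : q < 1) (n : ℕ) :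
    alphaWeight q n * alphaWeight q n = 1 - (q : ℂ) ^ (2 * (n + 1)) := by
  have : q ^ (2 * (n + 1)) ≤ 1 := pow_le_one₀ hq0.le hq1.le
  rw [alphaWeight, ← Complex.ofReal_mul, Real.mul_self_sqrt (by linarith)]
  push_cast
  rfl

theorem norm_alphaWeight_le (hq0 : 0 < q) (n : ℕ) : ‖alphaWeight q n‖ ≤ 1 := by
  have : 0 ≤ q ^ (2 * (n + 1)) := by positivity
  rw [alphaWeight, Complex.norm_real, Real.norm_of_nonneg (Real.sqrt_nonneg _), Real.sqrt_le_one]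
  linarith

variable (hq0 : 0 < q) (hq1 : q < 1)

/-- The weighted shift that represents `α`. -/
noncomputable def alphaOp : L2N →L[ℂ] L2N :=
  weightedComp (alphaWeight q) Nat.succ (norm_alphaWeight_le hq0) Nat.succ_injective

/-- The diagonal operator that represents `β`. -/
noncomputable def betaOp : L2N →L[ℂ] L2N :=
  weightedComp (fun n => (q : ℂ) ^ (n + 1)) id (fun n => by
    rw [norm_pow, Complex.norm_real, Real.norm_of_nonneg hq0.le]
    exact pow_le_one₀ hq0.le hq1.le) Function.injective_id

theorem alphaOp_e_succ (p : ℕ) : alphaOp hq0 (e (p + 1)) = alphaWeight q p • e p :=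
  weightedComp_e _ _ _ _ p

theorem alphaOp_e_zero : alphaOp hq0 (e 0) = 0 :=
  weightedComp_e_of_forall_ne _ _ _ _ fun p => p.succ_ne_zero

theorem star_alphaOp_e (p : ℕ) : star (alphaOp hq0) (e p) = alphaWeight q p • e (p + 1) := by
  rw [alphaOp, star_weightedComp_e, alphaWeight, Complex.conj_ofReal]

theorem betaOp_e (p : ℕ) : betaOp hq0 hq1 (e p) = (q : ℂ) ^ (p + 1) • e p :=
  weightedComp_e _ _ _ _ p

theorem star_betaOp : star (betaOp hq0 hq1) = betaOp hq0 hq1 := by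
  refine ext_e fun p => ?_
  rw [betaOp_e, betaOp, star_weightedComp_e, map_pow, Complex.conj_ofReal, id]

/-- The irreducible representation of `O(S³_q)` on `l²(ℕ)`. -/
noncomputable def sphereRep : QSphere q →ₐ[ℂ] (L2N →L[ℂ] L2N) :=
  lift (fun | al => alphaOp hq0 | alStar => star (alphaOp hq0) | _ => betaOp hq0 hq1) (by
    have hq : (q : ℂ) ≠ 0 := by exact_mod_cast hq0.ne'
    intro x y h
    refine ext_e fun p => ?_
    have hw := alphaWeight_mul_self hq0 hq1
    cases h
    all_goals simp only [letter, map_mul, map_add, map_smul, map_one, FreeAlgebra.lift_ι_apply,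
      mul_apply_eq_comp, add_apply,
      smul_apply, one_apply_eq_self, betaOp_e, star_alphaOp_e,
      alphaOp_e_succ, smul_smul]
    · rcases p with _ | p
      · simp [alphaOp_e_zero]
      · simp only [alphaOp_e_succ, map_smul, betaOp_e, smul_smul]
        congr 1; ring
    · rcases p with _ | p
      · simp [alphaOp_e_zero]
      · simp only [alphaOp_e_succ, map_smul, betaOp_e, smul_smul]
        congr 1; ring
    · congr 1; ring
    · congr 1; ring
    · rw [hw]
      rcases p with _ | p
      · simp only [alphaOp_e_zero, map_zero, zero_add]
        congr 1; field_simp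
      · simp only [alphaOp_e_succ, map_smul, star_alphaOp_e, smul_smul, hw, ← add_smul]
        congr 1; field_simp; ring
    · rw [hw, ← add_smul]
      convert one_smul ℂ (e p) using 2; ring)

theorem sphereRep_star (x : QSphere q) :
    sphereRep hq0 hq1 (star x) = star (sphereRep hq0 hq1 x) := by
  induction x using QSphere.induction with
  | algebraMap c =>
    rw [← algebraMap_star_comm, AlgHom.commutes, AlgHom.commutes, algebraMap_star_comm]
  | gen x =>
    rw [star_gen, sphereRep, lift_gen, lift_gen]
    cases x <;> simp [SphereGen.inv, star_betaOp]
  | add x y hx hy => rw [star_add, map_add, map_add, hx, hy, star_add]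
  | mul x y hx hy => rw [star_mul, map_mul, map_mul, hx, hy, star_mul]

theorem alphaOp_pow_e_add (l n : ℕ) : (alphaOp hq0 ^ l) (e (n + l)) =
    (∏ i ∈ Finset.range l, alphaWeight q (n + i)) • e n := by
  induction l with
  | zero => simp
  | succ l ih =>
    rw [pow_succ, mul_apply_eq_comp, ← add_assoc, alphaOp_e_succ, map_smul, ih,
      smul_smul, Finset.prod_range_succ, mul_comm]

theorem alphaOp_pow_e_of_lt {l n : ℕ} (h : n < l) : (alphaOp hq0 ^ l) (e n) = 0 := by
  induction l generalizing n with
  | zero => omega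
  | succ l ih =>
    rw [pow_succ, mul_apply_eq_comp]
    rcases n with _ | n
    · rw [alphaOp_e_zero, map_zero]
    · rw [alphaOp_e_succ, map_smul, ih (by omega), smul_zero]

theorem betaOp_pow_e (k n : ℕ) :
    (betaOp hq0 hq1 ^ k) (e n) = (q : ℂ) ^ (k * (n + 1)) • e n := by
  induction k with
  | zero => simp
  | succ k ih =>
    rw [pow_succ', mul_apply_eq_comp, ih, map_smul, betaOp_e, smul_smul]
    congr 1; ring

/-- The character of `O(S³_q)` with `α ↦ 1` and `β ↦ 0`. -/
noncomputable def character (q : ℝ) : QSphere q →ₐ[ℂ] ℂ :=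
  lift (fun | al => 1 | alStar => 1 | _ => 0) (by
    intro x y h
    cases h
    all_goals simp only [letter, map_mul, map_add, map_smul, map_one, FreeAlgebra.lift_ι_apply]
    all_goals simp)

theorem character_star (x : QSphere q) :
    character q (star x) = star (character q x) := by
  induction x using QSphere.induction with
  | algebraMap c =>
    rw [← algebraMap_star_comm, AlgHom.commutes, AlgHom.commutes, algebraMap_star_comm]
  | gen x =>
    rw [star_gen, character, lift_gen, lift_gen]
    cases x <;> simp [SphereGen.inv]
  | add x y hx hy => rw [star_add, map_add, map_add, hx, hy, star_add]
  | mul x y hx hy => rw [star_mul, map_mul, map_mul, hx, hy, star_mul]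

end QSphere

open QSphere SphereGen

/-! ### Existence of π_s and π₀. -/

namespace WP

variable {q : ℝ} (hq0 : 0 < q) (hq1 : q < 1) {k l : ℕ}

theorem sphereRep_a_e (n : ℕ) :
    sphereRep hq0 hq1 (a q k l : QSphere q) (e n) = (q : ℂ) ^ (2 * (n + 1)) • e n := by
  simp only [a, star_gen, map_mul, sphereRep, lift_gen, SphereGen.inv,
    mul_apply_eq_comp, betaOp_e, map_smul, smul_smul]
  congr 1; ring

theorem sphereRep_b_e_add (n : ℕ) : sphereRep hq0 hq1 (b q k l : QSphere q) (e (n + l)) =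
    ((q : ℂ) ^ (k * (n + l + 1)) * ∏ i ∈ Finset.range l, alphaWeight q (n + i)) • e n := by
  simp only [b, map_mul, map_pow, sphereRep, lift_gen, mul_apply_eq_comp,
    betaOp_pow_e, alphaOp_pow_e_add, map_smul, smul_smul]

theorem sphereRep_b_e_of_lt {n : ℕ} (h : n < l) :
    sphereRep hq0 hq1 (b q k l : QSphere q) (e n) = 0 := by
  simp only [b, map_mul, map_pow, sphereRep, lift_gen, mul_apply_eq_comp,
    betaOp_pow_e, alphaOp_pow_e_of_lt hq0 h, map_smul, smul_zero]

/-- The coisometry `e_{lp+r} ↦ e_p` that annihilates the other basis vectors. -/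
noncomputable def compression {l : ℕ} (hl : 0 < l) (r : ℕ) : L2N →L[ℂ] L2N :=
  weightedComp 1 (fun p => l * p + r) (by simp) fun m n h => by simpa [hl.ne'] using h

variable (hl : 0 < l) {r : ℕ}

theorem compression_e (p : ℕ) : compression hl r (e (l * p + r)) = e p :=
  (weightedComp_e 1 (fun p => l * p + r) _ _ p).trans (one_smul ℂ _)

theorem compression_e_of_forall_ne {j : ℕ} (h : ∀ p, l * p + r ≠ j) :
    compression hl r (e j) = 0 :=
  weightedComp_e_of_forall_ne _ _ _ _ h

theorem star_compression_e (p : ℕ) : star (compression hl r) (e p) = e (l * p + r) :=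
  (star_weightedComp_e 1 (fun p => l * p + r) _ _ p).trans (by simp)

theorem compression_mul_star : compression hl r * star (compression hl r) = 1 :=
  ext_e fun p => by simp [star_compression_e, compression_e]

open Classical in
theorem star_compression_mul_e (j : ℕ) : (star (compression hl r) * compression hl r) (e j) =
    (if ∃ p, l * p + r = j then (1 : ℂ) else 0) • e j := by
  split_ifs with h
  · obtain ⟨p, rfl⟩ := h
    simp [star_compression_e, compression_e]
  · simp [compression_e_of_forall_ne hl (not_exists.1 h)]

/-- The product C*C is the projection onto the span of the e_j with j in the class of `r` modulo
`l`. The operator of a is diagonal and that of b lowers the index by `l`; b* follows since the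
projection is self-adjoint. -/
theorem commute_sphereRep (hkl : k.Coprime l) (hr : r < l) (x : WP q k l) :
    Commute (star (compression hl r) * compression hl r) (sphereRep hq0 hq1 (x : QSphere q)) := by
  have hb : Commute (star (compression hl r) * compression hl r)
      (sphereRep hq0 hq1 (b q k l : QSphere q)) := by
    refine ext_e fun n => ?_
    rw [mul_apply_eq_comp, mul_apply_eq_comp (sphereRep _ _ _),
      star_compression_mul_e, map_smul]
    rcases lt_or_ge n l with h | h
    · rw [sphereRep_b_e_of_lt hq0 hq1 h, map_zero, smul_zero]
    · obtain ⟨n, rfl⟩ := Nat.exists_eq_add_of_le' h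
      rw [sphereRep_b_e_add, map_smul, star_compression_mul_e, smul_comm]
      have : (∃ p, l * p + r = n + l) ↔ ∃ p, l * p + r = n := by
        constructor
        -- The case p = 0 would give r = n + l, contradicting r < l.
        · rintro ⟨_ | p, hp⟩
          · omega
          · exact ⟨p, by rw [mul_add] at hp; omega⟩
        · rintro ⟨p, hp⟩
          exact ⟨p + 1, by rw [mul_add]; omega⟩
      by_cases hn : ∃ p, l * p + r = n
      · rw [if_pos hn, if_pos (this.2 hn)]
      · rw [if_neg hn, if_neg (mt this.1 hn)]
  induction x using WP.induction hq0.ne' hl hkl with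
  | algebraMap c =>
    have : ((algebraMap ℂ (WP q k l) c : WP q k l) : QSphere q) = algebraMap ℂ _ c := rfl
    rw [this, AlgHom.commutes]
    exact (Algebra.commutes _ _).symm
  | a =>
    refine ext_e fun n => ?_
    rw [mul_apply_eq_comp, mul_apply_eq_comp (sphereRep _ _ _),
      star_compression_mul_e, map_smul, sphereRep_a_e, map_smul, star_compression_mul_e,
      smul_comm]
  | b => exact hb
  | star_b =>
    rw [StarMemClass.coe_star, sphereRep_star]
    simpa using hb.star_star
  | add x y hx hy =>
    rw [AddMemClass.coe_add, map_add]
    exact hx.add_right hy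
  | mul x y hx hy =>
    rw [MulMemClass.coe_mul, map_mul]
    exact hx.mul_right hy

/-- The representation of `O(WP_q(k,l))` on the span of the vectors `e_{lp+r}`. -/
noncomputable def compressedRep (hkl : k.Coprime l) (hr : r < l) :
    WP q k l →⋆ₐ[ℂ] (L2N →L[ℂ] L2N) where
  toFun x := compression hl r * sphereRep hq0 hq1 (x : QSphere q) * star (compression hl r)
  map_one' := by simp [compression_mul_star]
  map_mul' x y := by
    have h := (commute_sphereRep hq0 hq1 hl hkl hr x).eq
    set C := compression hl r
    set R := sphereRep hq0 hq1
    -- Inserting C C* = 1 creates the projection C*C, which then passes through R x.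
    calc C * R (x * y : QSphere q) * star C
        = (C * star C) * C * (R x * R y) * star C := by
          rw [compression_mul_star, one_mul, map_mul]
      _ = C * (star C * C * R x) * R y * star C := by simp only [mul_assoc]
      _ = C * (R x * (star C * C)) * R y * star C := by rw [h]
      _ = _ := by simp only [mul_assoc]
  map_zero' := by simp
  map_add' x y := by simp [mul_add, add_mul]
  commutes' c := by
    have : ((algebraMap ℂ (WP q k l) c : WP q k l) : QSphere q) = algebraMap ℂ _ c := rfl
    rw [this, AlgHom.commutes, mul_assoc, Algebra.left_comm, compression_mul_star, mul_one]
  map_star' x := by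
    rw [StarMemClass.coe_star, sphereRep_star]
    simp [mul_assoc]

theorem compressedRep_apply_e (hkl : k.Coprime l) (hr : r < l) (x : WP q k l) (p : ℕ) :
    compressedRep hq0 hq1 hl hkl hr x (e p) =
      compression hl r (sphereRep hq0 hq1 (x : QSphere q) (e (l * p + r))) := by
  rw [← star_compression_e hl]; rfl

/-- The operator of β has eigenvalue q^{n+1} on e_n, so the residue class `r` realises the parameter
s = r + 1. -/
theorem isPi_compressedRep (hkl : k.Coprime l) (hr : r < l) :
    IsPi (r + 1) (compressedRep hq0 hq1 hl hkl hr) where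
  a_apply p := by
    rw [compressedRep_apply_e, sphereRep_a_e, map_smul, compression_e, add_assoc]
  b_apply_succ p := by
    rw [compressedRep_apply_e, mul_add, mul_one, add_right_comm, sphereRep_b_e_add, map_smul,
      compression_e]
    congr 1
    push_cast
    congr 1
    · congr 2; omega
    -- The powers of α collect weights by increasing index, whereas `IsPi` counts downwards; the
    -- natural subtraction never truncates because the index is at most `l`.
    · rw [← Finset.prod_range_reflect, ← Finset.Ico_add_one_right_eq_Icc,
        Finset.prod_Ico_eq_prod_range]
      refine Finset.prod_congr (by simp) fun i hi => ?_
      rw [Finset.mem_range] at hi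
      rw [alphaWeight]
      congr 5
      omega
  b_apply_zero := by
    rw [compressedRep_apply_e, sphereRep_b_e_of_lt hq0 hq1 (by simpa using hr), map_zero]

/-- The restriction of the character of the sphere. -/
noncomputable def character (q : ℝ) (k l : ℕ) : WP q k l →⋆ₐ[ℂ] ℂ where
  toAlgHom := (QSphere.character q).comp (WP q k l).toSubalgebra.val
  map_star' x := character_star (x : QSphere q)

theorem isPiZero_character (hk : 0 < k) : IsPiZero (character q k l) := by
  constructor
  · change QSphere.character q (gen q be * star (gen q be)) = 0
    simp [QSphere.character]
  · change QSphere.character q (gen q al ^ l * gen q be ^ k) = 0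
    simp [QSphere.character, hk.ne']

end WP

/-! ## Operators that shift the standard basis -/

/-- `T` maps `e_p` to a multiple of `e_{p+d}`, which is zero if `p + d < 0`. -/
def IsShift (d : ℤ) (T : L2N →L[ℂ] L2N) : Prop :=
  ∀ p : ℕ, T (e p) = 0 ∨ ∃ (c : ℂ) (j : ℕ), (j : ℤ) = p + d ∧ T (e p) = c • e j

theorem IsShift.mul {d d' : ℤ} {S T : L2N →L[ℂ] L2N} (hS : IsShift d S) (hT : IsShift d' T) :
    IsShift (d + d') (S * T) := by
  intro p
  rw [mul_apply_eq_comp]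
  rcases hT p with h | ⟨c, j, hj, h⟩
  · exact .inl (by rw [h, map_zero])
  · rcases hS j with h' | ⟨c', j', hj', h'⟩
    · exact .inl (by rw [h, map_smul, h', smul_zero])
    · exact .inr ⟨c * c', j', by omega, by rw [h, map_smul, h', smul_smul]⟩

theorem isShift_one : IsShift 0 1 := fun p => .inr ⟨1, p, by simp, by simp⟩

theorem IsShift.pow {d : ℤ} {T : L2N →L[ℂ] L2N} (hT : IsShift d T) (n : ℕ) :
    IsShift (n * d) (T ^ n) := by
  induction n with
  | zero => simpa using isShift_one
  | succ n ih =>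
    have h := ih.mul hT
    rw [pow_succ]
    convert h using 1
    push_cast
    ring

theorem IsShift.inner_eq_zero {d : ℤ} {T : L2N →L[ℂ] L2N} (hT : IsShift d T) (hd : d ≠ 0)
    (p : ℕ) : inner ℂ (e p) (T (e p)) = 0 := by
  rcases hT p with h | ⟨c, j, hj, h⟩
  · rw [h, inner_zero_right]
  · have : p ≠ j := by omega
    rw [h, inner_smul_right, inner_e_left, e_apply, if_neg this, mul_zero]

theorem ampliation_eq_smul {A : Type*} [Ring A] [StarRing A] [Algebra ℂ A] (π₀ : A →⋆ₐ[ℂ] ℂ)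
    (x : A) : ampliation π₀ x = π₀ x • 1 :=
  Algebra.algebraMap_eq_smul_one (A := L2N →L[ℂ] L2N) (π₀ x)

theorem IsPiZero.map_monomial {q : ℝ} {k l : ℕ} {π₀ : WP q k l →⋆ₐ[ℂ] ℂ} (h : IsPiZero π₀)
    {m : ℕ} {n : ℤ} (hmn : ¬(m = 0 ∧ n = 0)) :
    π₀ (WP.a q k l ^ m * WP.bpow q k l n) = 0 := by
  rw [map_mul, map_pow, h.1]
  rcases eq_or_ne m 0 with rfl | hm
  · have hn : n ≠ 0 := fun hn => hmn ⟨rfl, hn⟩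
    unfold WP.bpow
    split_ifs
    · rw [map_pow, h.2, zero_pow (n := n.toNat) (by omega), mul_zero]
    · rw [map_pow, map_star, h.2, star_zero, zero_pow (n := (-n).toNat) (by omega), mul_zero]
  · rw [zero_pow hm, zero_mul]

/-! ### Trace class estimates and values of the trace. -/

namespace IsPi

variable {q : ℝ} {k l s : ℕ} {π : WP q k l →⋆ₐ[ℂ] (L2N →L[ℂ] L2N)}

/-- The weights of `π_s(b)`. -/
noncomputable def bWeight (q : ℝ) (k l s p : ℕ) : ℝ :=
  q ^ (k * (l * (p + 1) + s)) *
    ∏ r ∈ Finset.Icc 1 l, √(1 - q ^ (2 * (l * (p + 1) + s - r)))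

/-- The square roots are at most 1, and k(l(p + 1) + s) ≥ p since k, l ≥ 1. -/
theorem abs_bWeight_le (hq0 : 0 < q) (hq1 : q < 1) (hk : 0 < k) (hl : 0 < l) (p : ℕ) :
    |bWeight q k l s p| ≤ q ^ p := by
  have h0 : 0 ≤ ∏ r ∈ Finset.Icc 1 l, √(1 - q ^ (2 * (l * (p + 1) + s - r))) :=
    Finset.prod_nonneg fun _ _ => Real.sqrt_nonneg _
  have h1 : ∏ r ∈ Finset.Icc 1 l, √(1 - q ^ (2 * (l * (p + 1) + s - r))) ≤ 1 := by
    refine Finset.prod_le_one (fun _ _ => Real.sqrt_nonneg _) fun r _ => ?_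
    have : 0 ≤ q ^ (2 * (l * (p + 1) + s - r)) := by positivity
    rw [Real.sqrt_le_one]
    linarith
  rw [bWeight, abs_of_nonneg (by positivity)]
  refine (mul_le_of_le_one_right (by positivity) h1).trans ?_
  exact pow_le_pow_of_le_one hq0.le hq1.le (by nlinarith [Nat.mul_le_mul hk hl])

/-- `IsPi` prescribes only b; its real matrix coefficients determine those of the adjoint. -/
theorem star_b_apply (h : IsPi s π) (p : ℕ) :
    π (star (WP.b q k l)) (e p) = (bWeight q k l s p : ℂ) • e (p + 1) := by
  ext n
  rw [← inner_e_left, map_star, ContinuousLinearMap.star_eq_adjoint,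
    ContinuousLinearMap.adjoint_inner_right, lp.coeFn_smul, Pi.smul_apply, smul_eq_mul]
  rcases n with _ | n
  · rw [h.b_apply_zero]
    simp [e_apply]
  · rw [h.b_apply_succ, inner_smul_left, inner_e_left, Complex.conj_ofReal]
    by_cases hn : n = p
    · subst hn
      simp [e_apply, bWeight]
    · simp [e_apply, hn]

theorem isTraceClass_of_norm_le {q : ℝ} (hq0 : 0 < q) (hq1 : q < 1) {T : L2N →L[ℂ] L2N}
    (h : ∀ p, ‖T (e p)‖ ≤ q ^ p) : IsTraceClass T := by
  refine HilbertBasis.isTraceClass eBasis ?_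
  simp only [eBasis_apply]
  exact Summable.of_nonneg_of_le (fun _ => norm_nonneg _) h
    (summable_geometric_of_lt_one hq0.le hq1)

theorem norm_smul_e (c : ℂ) (p : ℕ) : ‖c • e p‖ = ‖c‖ := by rw [norm_smul, norm_e, mul_one]

theorem isTraceClass_sub (hq0 : 0 < q) (hq1 : q < 1) (hk : 0 < k) (hl : 0 < l)
    (hkl : k.Coprime l) (h : IsPi s π) {π₀ : WP q k l →⋆ₐ[ℂ] ℂ} (h₀ : IsPiZero π₀)
    (x : WP q k l) : IsTraceClass (π x - ampliation π₀ x) := by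
  induction x using WP.induction hq0.ne' hl hkl with
  | algebraMap c =>
    rw [AlgHomClass.commutes, AlgHomClass.commutes, sub_self]
    exact isTraceClass_zero
  | a =>
    rw [ampliation_eq_smul, h₀.1, zero_smul, sub_zero]
    refine isTraceClass_of_norm_le hq0 hq1 fun p => ?_
    rw [h.a_apply, norm_smul_e, norm_pow, Complex.norm_real, Real.norm_of_nonneg hq0.le]
    exact pow_le_pow_of_le_one hq0.le hq1.le (by nlinarith)
  | b =>
    rw [ampliation_eq_smul, h₀.2, zero_smul, sub_zero]
    -- The weights of b are indexed by the target e_p of e_{p+1}, so the first term is dropped.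
    refine HilbertBasis.isTraceClass eBasis ((summable_nat_add_iff 1).1 ?_)
    refine Summable.of_nonneg_of_le (fun _ => norm_nonneg _) (fun p => ?_)
      (summable_geometric_of_lt_one hq0.le hq1)
    rw [eBasis_apply, h.b_apply_succ, norm_smul_e, Complex.norm_real]
    exact abs_bWeight_le hq0 hq1 hk hl p
  | star_b =>
    rw [ampliation_eq_smul, map_star π₀, h₀.2, star_zero, zero_smul, sub_zero]
    refine isTraceClass_of_norm_le hq0 hq1 fun p => ?_
    rw [h.star_b_apply, norm_smul_e, Complex.norm_real]
    exact abs_bWeight_le hq0 hq1 hk hl p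
  | add x y hx hy =>
    convert hx.add hy using 1
    rw [map_add, map_add]
    abel
  | mul x y hx hy =>
    -- T(xy) = π(x)T(y) + π₀(y)T(x), with T = π - π₀I.
    convert (hy.mul_left (π x)).add (hx.smul (π₀ y)) using 1
    rw [map_mul, map_mul, ampliation_eq_smul, ampliation_eq_smul]
    simp only [mul_sub, smul_sub, mul_smul_comm, mul_one, smul_smul,
      mul_comm (π₀ y)]
    abel

theorem isShift_a (h : IsPi s π) : IsShift 0 (π (WP.a q k l)) := fun p =>
  .inr ⟨_, p, by simp, h.a_apply p⟩

theorem isShift_b (h : IsPi s π) : IsShift (-1) (π (WP.b q k l)) := by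
  rintro (_ | p)
  · exact .inl h.b_apply_zero
  · exact .inr ⟨_, p, by simp, h.b_apply_succ p⟩

theorem isShift_star_b (h : IsPi s π) : IsShift 1 (π (star (WP.b q k l))) := fun p =>
  .inr ⟨_, p + 1, by simp, h.star_b_apply p⟩

theorem isShift_monomial (h : IsPi s π) (m : ℕ) (n : ℤ) :
    IsShift (-n) (π (WP.a q k l ^ m * WP.bpow q k l n)) := by
  rw [map_mul, map_pow, ← zero_add (-n), ← mul_zero (m : ℤ)]
  refine (h.isShift_a.pow m).mul ?_
  unfold WP.bpow
  split_ifs with hn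
  · rw [map_pow]
    convert h.isShift_b.pow n.toNat using 1
    omega
  · rw [map_pow]
    convert h.isShift_star_b.pow (-n).toNat using 1
    omega

theorem a_pow_apply (h : IsPi s π) (m p : ℕ) : π (WP.a q k l ^ m) (e p) =
    ((q : ℂ) ^ (2 * m * s) * ((q : ℂ) ^ (2 * m * l)) ^ p) • e p := by
  induction m with
  | zero => simp
  | succ m ih =>
    rw [pow_succ', map_mul, mul_apply_eq_comp, ih, map_smul, h.a_apply, smul_smul]
    congr 1
    ring

theorem hasTrace_value (hq0 : 0 < q) (hq1 : q < 1) (hl : 0 < l) (h : IsPi s π)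
    {π₀ : WP q k l →⋆ₐ[ℂ] ℂ} (h₀ : IsPiZero π₀) {m : ℕ} {n : ℤ} {t : ℂ}
    (ht : HasTrace (π (WP.a q k l ^ m * WP.bpow q k l n) -
      ampliation π₀ (WP.a q k l ^ m * WP.bpow q k l n)) t) :
    t = if n = 0 ∧ m ≠ 0 then (q : ℂ) ^ (2 * m * s) / (1 - (q : ℂ) ^ (2 * m * l)) else 0 := by
  have hsum : HasSum (fun p => inner ℂ (e p) ((π (WP.a q k l ^ m * WP.bpow q k l n) -
      ampliation π₀ (WP.a q k l ^ m * WP.bpow q k l n)) (e p))) t := by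
    simpa only [eBasis_apply] using ht.2 ℕ eBasis
  have hb0 : WP.bpow q k l 0 = 1 := by simp [WP.bpow]
  -- For the unit the difference π - π₀I is zero; for every other monomial the π₀ term drops out.
  by_cases hmn : m = 0 ∧ n = 0
  · obtain ⟨rfl, rfl⟩ := hmn
    simp only [hb0, pow_zero, mul_one, map_one, sub_self, zero_apply, inner_zero_right] at hsum
    simpa using hsum.unique hasSum_zero
  rw [ampliation_eq_smul, h₀.map_monomial hmn, zero_smul, sub_zero] at hsum
  by_cases hn : n = 0
  · subst hn
    have hm : m ≠ 0 := fun hm => hmn ⟨hm, rfl⟩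
    rw [if_pos ⟨rfl, hm⟩]
    simp only [hb0, mul_one, h.a_pow_apply, inner_smul_right, inner_e_left, e_apply, if_true]
      at hsum
    have hq : ‖(q : ℂ) ^ (2 * m * l)‖ < 1 := by
      rw [norm_pow, Complex.norm_real, Real.norm_of_nonneg hq0.le]
      exact pow_lt_one₀ hq0.le hq1 (mul_ne_zero (mul_ne_zero two_ne_zero hm) hl.ne')
    have hgeom := (hasSum_geometric_of_norm_lt_one hq).mul_left ((q : ℂ) ^ (2 * m * s))
    rw [← div_eq_mul_inv] at hgeom
    exact hsum.unique hgeom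
  · rw [if_neg fun h => hn h.1]
    refine hsum.unique ?_
    simp only [(h.isShift_monomial m n).inner_eq_zero (neg_ne_zero.2 hn)]
    exact hasSum_zero

end IsPi

/-! ### The trace as a functional and the Fredholm module. -/

section Character

variable {A : Type*} [Ring A] [StarRing A] [Algebra ℂ A] {π : A →⋆ₐ[ℂ] (L2N →L[ℂ] L2N)}
  {π₀ : A →⋆ₐ[ℂ] ℂ}

/-- If `π(x) - π₀(x)` is always trace class, then its trace is a linear functional. -/
theorem exists_linearMap_hasTrace (h : ∀ x, IsTraceClass (π x - ampliation π₀ x)) :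
    ∃ τ : A →ₗ[ℂ] ℂ, ∀ x, HasTrace (π x - ampliation π₀ x) (τ x) := by
  choose t ht using fun x => (h x).exists_hasTrace
  refine ⟨⟨⟨t, fun x y => (ht _).unique ?_⟩, fun c x => (ht _).unique ?_⟩, ht⟩
  · convert (ht x).add (ht y) using 1
    rw [map_add, map_add]
    abel
  · change HasTrace _ (c * t x)
    convert (ht x).smul c using 1
    rw [map_smul, map_smul, smul_sub]

/-- The scalars π₀(x), π₀(y) commute, so the two operators differ by -[π(y), π(x) - π₀(x)I], a
commutator with a trace class operator. -/
theorem HasTrace.mul_comm_of_sub_ampliation {x y : A} {s t : ℂ}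
    (hx : IsTraceClass (π x - ampliation π₀ x))
    (hs : HasTrace (π (x * y) - ampliation π₀ (x * y)) s)
    (ht : HasTrace (π (y * x) - ampliation π₀ (y * x)) t) : s = t := by
  have h := hs.sub ht
  have h' := HasTrace.commutator (S := π y) hx
  have hst : π (x * y) - ampliation π₀ (x * y) - (π (y * x) - ampliation π₀ (y * x)) =
      (-1 : ℂ) • (π y * (π x - ampliation π₀ x) - (π x - ampliation π₀ x) * π y) := by
    rw [map_mul, map_mul, ampliation_eq_smul, ampliation_eq_smul, ampliation_eq_smul,
      map_mul, map_mul]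
    simp [mul_sub, sub_mul, smul_smul, mul_comm (π₀ y)]
  rw [hst] at h
  simpa [sub_eq_zero] using h.unique (h'.smul (-1))

theorem isEvenFredholmModule_directSum (h : ∀ x, IsTraceClass (π x - ampliation π₀ x)) :
    IsEvenFredholmModule (directSum π (ampliation π₀)) (flipOp L2N) (grading L2N) where
  F_selfAdjoint := star_flipOp
  F_sq := flipOp_mul_flipOp
  compact_commutator x := (h x).flipOp_commutator.isCompactOperator
  γ_selfAdjoint := star_grading
  γ_sq := grading_mul_grading
  γ_commute x := by
    change grading L2N * block _ _ _ _ = block _ _ _ _ * grading L2N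
    simp [grading, block_mul]
  γ_anticommute := grading_mul_flipOp

end Character

end QuantumTeardrop

open QuantumTeardrop in
theorem proposition4p1 (q : ℝ) (hq0 : 0 < q) (hq1 : q < 1) (k l : ℕ) (hk : 0 < k) (hl : 0 < l)
    (hkl : Nat.Coprime k l) (s : ℕ) (hs1 : 1 ≤ s) (hsl : s ≤ l) :
    (∃! π₀ : WP q k l →⋆ₐ[ℂ] ℂ, IsPiZero π₀) ∧
    (∃! πs : WP q k l →⋆ₐ[ℂ] (L2N →L[ℂ] L2N), IsPi s πs) ∧
    ∀ (π₀ : WP q k l →⋆ₐ[ℂ] ℂ) (πs : WP q k l →⋆ₐ[ℂ] (L2N →L[ℂ] L2N)),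
      IsPiZero π₀ → IsPi s πs →
      IsEvenFredholmModule (directSum πs (ampliation π₀)) (flipOp L2N) (grading L2N) ∧
      IsOneSummable (directSum πs (ampliation π₀)) (flipOp L2N) ∧
      ∃ τ : WP q k l →ₗ[ℂ] ℂ,
        IsChernCharacter (directSum πs (ampliation π₀)) (flipOp L2N) (grading L2N) τ ∧
        (∀ x y, τ (x * y) = τ (y * x)) ∧
        (∀ x, HasTrace (πs x - ampliation π₀ x) (τ x)) ∧
        (∀ (m : ℕ) (n : ℤ), ¬ (m = 0 ∧ n = 0) →
          HasTrace (grading L2N *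
            directSum πs (ampliation π₀) (WP.a q k l ^ m * WP.bpow q k l n))
            (τ (WP.a q k l ^ m * WP.bpow q k l n))) ∧
        ∀ (m : ℕ) (n : ℤ), τ (WP.a q k l ^ m * WP.bpow q k l n) =
          if n = 0 ∧ m ≠ 0 then (q : ℂ) ^ (2 * m * s) / (1 - (q : ℂ) ^ (2 * m * l)) else 0 := by
  refine ⟨⟨WP.character q k l, WP.isPiZero_character hk, fun π h => ?_⟩, ?_, ?_⟩
  · exact WP.starAlgHom_ext hq0.ne' hl hkl (h.1.trans (WP.isPiZero_character hk).1.symm)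
      (h.2.trans (WP.isPiZero_character hk).2.symm)
  -- With s = r + 1 the bound s ≤ l is exactly r < l, so `r` is a residue modulo `l`.
  · obtain ⟨r, rfl⟩ := Nat.exists_eq_add_of_le' hs1
    have hP := WP.isPi_compressedRep hq0 hq1 hl hkl hsl
    refine ⟨_, hP, fun π h => WP.starAlgHom_ext hq0.ne' hl hkl (ext_e fun p => ?_)
      (ext_e fun p => ?_)⟩
    · rw [h.a_apply, hP.a_apply]
    · rcases p with _ | p
      · rw [h.b_apply_zero, hP.b_apply_zero]
      · rw [h.b_apply_succ, hP.b_apply_succ]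
  · intro π₀ πs h₀ h
    have htc := h.isTraceClass_sub hq0 hq1 hk hl hkl h₀
    obtain ⟨τ, hτ⟩ := exists_linearMap_hasTrace htc
    refine ⟨isEvenFredholmModule_directSum htc, fun x => (htc x).flipOp_commutator, τ,
      fun x => (hτ x).grading_flipOp_commutator,
      fun x y => HasTrace.mul_comm_of_sub_ampliation (htc x) (hτ _) (hτ _), hτ, fun m n hmn => ?_,
      fun m n => h.hasTrace_value hq0 hq1 hl h₀ (hτ _)⟩
    have hx := hτ (WP.a q k l ^ m * WP.bpow q k l n)
    change HasTrace (grading L2N * block _ 0 0 _) _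
    -- As π₀ kills the monomial, γπ̄_s is diag(π_s, 0) on it, with the same trace as π_s - π.
    have h0 : ampliation π₀ (WP.a q k l ^ m * WP.bpow q k l n) = 0 := by
      rw [ampliation_eq_smul, h₀.map_monomial hmn, zero_smul]
    rw [h0, sub_zero] at hx
    rw [h0]
    simpa [grading, block_mul] using hx.block_left
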